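/- Let $(X,\Sigma,\mu)$ be a $\sigma$-finite measure space, $\mathcal A\subseteq\Sigma$ a $\sigma$-subalgebra such that $\mu|_{\mathcal A}$ is $\sigma$-finite, and $E$ the conditional expectation relative to $\mathcal A$. It is defined for all nonnegative measurable functions, with values in $[0,\infty]$, and for all conditionable functions, i.e. (classes of) measurable complex functions $g$ with $E(|g|)<\infty$ a.e. Let $u,w$ be conditionable complex functions such that $uf$ is conditionable for every $f\in L^2(\mu)$. Let $T=M_wEM_u$ be the weighted conditional type (WCT) operator in $L^2(\mu)$, that is, $Tf=wE(uf)$ with domain $\mathcal D(T)=\{f\in L^2(\mu): uf \text{ is conditionable and } wE(uf)\in L^2(\mu)\}$. Suppose that $T$ is densely defined. Then $E(|u|^2)<\infty$ and $E(|u|^2)E(|w|^2)<\infty$ a.e. (with $0\cdot\infty=0$), and the orthogonal projection $P$ of $L^2(\mu)\oplus L^2(\mu)$ onto the graph $\mathcal G(T)=\{(f,Tf): f\in\mathcal D(T)\}$ exists (equivalently, $T$ is closed). Put $$h=\frac{1}{1+E(|u|^2)E(|w|^2)},\qquad h_1=E(|w|^2)\,h,\qquad h_2=E(|u|^2)\,h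 .$$ The entries of the characteristic matrix $P=(P_{ij})_{i,j\in\{1,2\}}$ of $T$, which are bounded operators on $L^2(\mu)$, are $$P_{11}=I-M_{h_1\bar u}EM_u,\quad P_{21}=M_hM_wEM_u,\quad P_{12}=M_hM_{\bar u}EM_{\bar w},\quad P_{22}=M_{h_2}M_wEM_{\bar w},$$ that is, for every $f\in L^2(\mu)$, a.e. on $X$, $$P_{11}f=f-h_1\bar u\,E(uf),\quad P_{21}f=h\,w\,E(uf),\quad P_{12}f=h\,\bar u\,E(\bar wf),\quad P_{22}f=h_2\,w\,E(\bar wf).$$ (On the set where $E(|w|^2)=\infty$ one has $u=0$ and $E(|u|^2)=0$ a.e., and there the products $h_1\bar u E(uf)$, $h\bar uE(\bar wf)$ and $h_2wE(\bar wf)$ are read as $0$.) -/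

import Mathlib

open MeasureTheory
open scoped ENNReal

noncomputable section

section CondExp

variable {X : Type*}

/-- For `g : X → ℝ`, the difference `E(g⁺) - E(g⁻)` of the conditional expectations relative to
the sub-σ-algebra `A` of the positive and the negative part, where on nonnegative functions `E` is
the Radon–Nikodym conditional expectation `condLExp` with values in `[0, ∞]`. -/
def condExpReal (A : MeasurableSpace X) {mX : MeasurableSpace X} (μ : Measure X)
    (g : X → ℝ) (x : X) : ℝ :=
  (condLExp A μ (fun y => ENNReal.ofReal (g y)) x).toReal -
    (condLExp A μ (fun y => ENNReal.ofReal (-g y)) x).toReal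

/-- The conditional expectation `E(g) = E(Re g) + i E(Im g)` of a complex function `g`. It is
meaningful at (almost) every point where `E(|g|) < ∞`; the function `g` need not be integrable. -/
def condExpC (A : MeasurableSpace X) {mX : MeasurableSpace X} (μ : Measure X)
    (g : X → ℂ) (x : X) : ℂ :=
  ⟨condExpReal A μ (fun y => (g y).re) x, condExpReal A μ (fun y => (g y).im) x⟩

/-- `g` is conditionable: it is measurable (modulo null sets) and `E(|g|) < ∞` almost
everywhere. -/
def Conditionable (A : MeasurableSpace X) {mX : MeasurableSpace X} (μ : Measure X)
    (g : X → ℂ) : Prop :=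
  AEMeasurable g μ ∧ ∀ᵐ x ∂μ, condLExp A μ (fun y => ‖g y‖ₑ) x < ∞

/-- `E(|g|²)`, with values in `[0, ∞]`. -/
def condSq (A : MeasurableSpace X) {mX : MeasurableSpace X} (μ : Measure X)
    (g : X → ℂ) : X → ℝ≥0∞ :=
  condLExp A μ (fun y => ‖g y‖ₑ ^ 2)

variable {A mX : MeasurableSpace X} {μ : Measure X}

theorem condExpReal_congr {g k : X → ℝ} (h : g =ᵐ[μ] k) :
    condExpReal A μ g =ᵐ[μ] condExpReal A μ k := by
  have h1 := condLExp_congr_ae (mΩ := A) (P := μ)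
    (h.mono fun x hx => by simp only [hx] :
      (fun y => ENNReal.ofReal (g y)) =ᵐ[μ] fun y => ENNReal.ofReal (k y))
  have h2 := condLExp_congr_ae (mΩ := A) (P := μ)
    (h.mono fun x hx => by simp only [hx] :
      (fun y => ENNReal.ofReal (-g y)) =ᵐ[μ] fun y => ENNReal.ofReal (-k y))
  filter_upwards [h1, h2] with x hx1 hx2
  simp only [condExpReal, hx1, hx2]

theorem condExpC_congr {g k : X → ℂ} (h : g =ᵐ[μ] k) :
    condExpC A μ g =ᵐ[μ] condExpC A μ k := by
  have h1 := condExpReal_congr (A := A)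
    (h.mono fun x hx => by simp only [hx] : (fun y => (g y).re) =ᵐ[μ] fun y => (k y).re)
  have h2 := condExpReal_congr (A := A)
    (h.mono fun x hx => by simp only [hx] : (fun y => (g y).im) =ᵐ[μ] fun y => (k y).im)
  filter_upwards [h1, h2] with x hx1 hx2
  simp only [condExpC, hx1, hx2]

theorem condExpReal_add {g k : X → ℝ} (hg : AEMeasurable g μ) (hk : AEMeasurable k μ)
    (hg' : ∀ᵐ x ∂μ, condLExp A μ (fun y => ‖g y‖ₑ) x < ∞)
    (hk' : ∀ᵐ x ∂μ, condLExp A μ (fun y => ‖k y‖ₑ) x < ∞) :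
    condExpReal A μ (fun x => g x + k x) =ᵐ[μ]
      fun x => condExpReal A μ g x + condExpReal A μ k x := by
  have hle : ∀ r : X → ℝ, (∀ᵐ x ∂μ, condLExp A μ (fun y => ‖r y‖ₑ) x < ∞) →
      ∀ᵐ x ∂μ, condLExp A μ (fun y => ENNReal.ofReal (r y)) x < ∞ ∧
        condLExp A μ (fun y => ENNReal.ofReal (-r y)) x < ∞ := by
    intro r hr
    have m1 : condLExp A μ (fun y => ENNReal.ofReal (r y)) ≤ᵐ[μ]
        condLExp A μ (fun y => ‖r y‖ₑ) := condLExp_mono <| ae_of_all _ fun y => by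
      simp only [← ofReal_norm]
      exact ENNReal.ofReal_le_ofReal (le_abs_self _)
    have m2 : condLExp A μ (fun y => ENNReal.ofReal (-r y)) ≤ᵐ[μ]
        condLExp A μ (fun y => ‖r y‖ₑ) := condLExp_mono <| ae_of_all _ fun y => by
      simp only [← ofReal_norm]
      exact ENNReal.ofReal_le_ofReal (neg_le_abs _)
    filter_upwards [hr, m1, m2] with x hx h1 h2
    exact ⟨h1.trans_lt hx, h2.trans_lt hx⟩
  have hgk' : ∀ᵐ x ∂μ, condLExp A μ (fun y => ‖g y + k y‖ₑ) x < ∞ := by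
    have m : condLExp A μ (fun y => ‖g y + k y‖ₑ) ≤ᵐ[μ]
        condLExp A μ ((fun y => ‖g y‖ₑ) + fun y => ‖k y‖ₑ) :=
      condLExp_mono <| ae_of_all _ fun y => enorm_add_le _ _
    have a := condLExp_add_left (mΩ := A) (P := μ) (X := fun y => ‖g y‖ₑ)
      (fun y => ‖k y‖ₑ) hg.enorm
    filter_upwards [m, a, hg', hk'] with x h1 h2 h3 h4
    refine h1.trans_lt ?_
    rw [h2]
    exact ENNReal.add_lt_top.2 ⟨h3, h4⟩
  have add3 : ∀ a b c : X → ℝ≥0∞, AEMeasurable a μ → AEMeasurable b μ →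
      condLExp A μ (a + (b + c)) =ᵐ[μ]
        fun x => condLExp A μ a x + (condLExp A μ b x + condLExp A μ c x) := by
    intro a b c ha hb
    filter_upwards [condLExp_add_left (mΩ := A) (P := μ) (b + c) ha,
      condLExp_add_left (mΩ := A) (P := μ) c hb] with x h1 h2
    rw [h1, Pi.add_apply, h2, Pi.add_apply]
  have e : ((fun y => ENNReal.ofReal (g y + k y)) + ((fun y => ENNReal.ofReal (-g y)) +
        fun y => ENNReal.ofReal (-k y))) =
      ((fun y => ENNReal.ofReal (-(g y + k y))) + ((fun y => ENNReal.ofReal (g y)) +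
        fun y => ENNReal.ofReal (k y))) := by
    funext y
    simp only [Pi.add_apply]
    rw [← ENNReal.toReal_eq_toReal_iff' (by simp) (by simp)]
    rw [ENNReal.toReal_add (by simp) (by simp), ENNReal.toReal_add (by simp) (by simp),
      ENNReal.toReal_add (by simp) (by simp), ENNReal.toReal_add (by simp) (by simp)]
    simp only [ENNReal.toReal_ofReal']
    have key : ∀ t : ℝ, max t 0 = t + max (-t) 0 := by
      intro t
      rcases le_total t 0 with h | h
      · rw [max_eq_right h, max_eq_left (by linarith)]; ring
      · rw [max_eq_left h, max_eq_right (by linarith)]; ring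
    rw [key (g y + k y), key (g y), key (k y)]
    ring
  have s1 := add3 (fun y => ENNReal.ofReal (g y + k y)) (fun y => ENNReal.ofReal (-g y))
    (fun y => ENNReal.ofReal (-k y)) (hg.add hk).ennreal_ofReal hg.neg.ennreal_ofReal
  have s2 := add3 (fun y => ENNReal.ofReal (-(g y + k y))) (fun y => ENNReal.ofReal (g y))
    (fun y => ENNReal.ofReal (k y)) (hg.add hk).neg.ennreal_ofReal hg.ennreal_ofReal
  rw [e] at s1
  filter_upwards [s1, s2, hle g hg', hle k hk', hle (fun y => g y + k y) hgk']
    with x h1 h2 h3 h4 h5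
  rw [h1] at h2
  have h6 := congrArg ENNReal.toReal h2
  rw [ENNReal.toReal_add h5.1.ne (ENNReal.add_ne_top.2 ⟨h3.2.ne, h4.2.ne⟩),
    ENNReal.toReal_add h3.2.ne h4.2.ne,
    ENNReal.toReal_add h5.2.ne (ENNReal.add_ne_top.2 ⟨h3.1.ne, h4.1.ne⟩),
    ENNReal.toReal_add h3.1.ne h4.1.ne] at h6
  simp only [condExpReal]
  linarith

theorem condExpReal_const_mul (c : ℝ) (g : X → ℝ) :
    condExpReal A μ (fun x => c * g x) =ᵐ[μ] fun x => c * condExpReal A μ g x := by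
  have pos : ∀ (d : ℝ) (r : X → ℝ), 0 ≤ d →
      condLExp A μ (fun y => ENNReal.ofReal (d * r y)) =ᵐ[μ]
        fun x => ENNReal.ofReal d * condLExp A μ (fun y => ENNReal.ofReal (r y)) x := by
    intro d r hd
    have := condLExp_smul' (mΩ := A) (P := μ) (fun y => ENNReal.ofReal (r y))
      (c := ENNReal.ofReal d) ENNReal.ofReal_ne_top
    have e : (ENNReal.ofReal d • fun y => ENNReal.ofReal (r y)) =
        fun y => ENNReal.ofReal (d * r y) := by
      funext y
      simp [ENNReal.ofReal_mul hd]
    rw [e] at this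
    exact this
  rcases le_total 0 c with hc | hc
  · filter_upwards [pos c g hc, pos c (fun y => -g y) hc] with x h1 h2
    simp only [mul_neg] at h2
    simp only [condExpReal, h1, h2, ENNReal.toReal_mul, ENNReal.toReal_ofReal hc]
    ring
  · have hc' : 0 ≤ -c := by linarith
    filter_upwards [pos (-c) g hc', pos (-c) (fun y => -g y) hc'] with x h1 h2
    have e1 : ∀ y, -c * g y = -(c * g y) := fun y => by ring
    have e2 : ∀ y, -c * -g y = c * g y := fun y => by ring
    simp only [e1] at h1
    simp only [e2] at h2
    simp only [condExpReal, h1, h2, ENNReal.toReal_mul, ENNReal.toReal_ofReal hc']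
    ring

theorem Conditionable.re {g : X → ℂ} (hg : Conditionable A μ g) :
    AEMeasurable (fun x => (g x).re) μ ∧
      ∀ᵐ x ∂μ, condLExp A μ (fun y => ‖(g y).re‖ₑ) x < ∞ := by
  refine ⟨Complex.measurable_re.comp_aemeasurable hg.1, ?_⟩
  have m : condLExp A μ (fun y => ‖(g y).re‖ₑ) ≤ᵐ[μ] condLExp A μ (fun y => ‖g y‖ₑ) :=
    condLExp_mono <| ae_of_all _ fun y => by
      simp only [← ofReal_norm]
      exact ENNReal.ofReal_le_ofReal (Complex.abs_re_le_norm _)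
  filter_upwards [m, hg.2] with x h1 h2 using h1.trans_lt h2

theorem Conditionable.im {g : X → ℂ} (hg : Conditionable A μ g) :
    AEMeasurable (fun x => (g x).im) μ ∧
      ∀ᵐ x ∂μ, condLExp A μ (fun y => ‖(g y).im‖ₑ) x < ∞ := by
  refine ⟨Complex.measurable_im.comp_aemeasurable hg.1, ?_⟩
  have m : condLExp A μ (fun y => ‖(g y).im‖ₑ) ≤ᵐ[μ] condLExp A μ (fun y => ‖g y‖ₑ) :=
    condLExp_mono <| ae_of_all _ fun y => by
      simp only [← ofReal_norm]
      exact ENNReal.ofReal_le_ofReal (Complex.abs_im_le_norm _)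
  filter_upwards [m, hg.2] with x h1 h2 using h1.trans_lt h2

theorem Conditionable.congr {g k : X → ℂ} (hg : Conditionable A μ g) (h : g =ᵐ[μ] k) :
    Conditionable A μ k := by
  refine ⟨hg.1.congr h, ?_⟩
  have e := condLExp_congr_ae (mΩ := A) (P := μ)
    (h.mono fun x hx => by simp only [hx] : (fun y => ‖g y‖ₑ) =ᵐ[μ] fun y => ‖k y‖ₑ)
  filter_upwards [hg.2, e] with x h1 h2
  rwa [← h2]

theorem Conditionable.zero : Conditionable A μ (fun _ => (0 : ℂ)) := by
  refine ⟨aemeasurable_const, ?_⟩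
  have e : (fun _ : X => ‖(0 : ℂ)‖ₑ) = (0 : X → ℝ≥0∞) := by funext; simp
  rw [e, condLExp_zero]
  simp

theorem Conditionable.add {g k : X → ℂ} (hg : Conditionable A μ g) (hk : Conditionable A μ k) :
    Conditionable A μ (fun x => g x + k x) := by
  refine ⟨hg.1.add hk.1, ?_⟩
  have m : condLExp A μ (fun y => ‖g y + k y‖ₑ) ≤ᵐ[μ]
      condLExp A μ ((fun y => ‖g y‖ₑ) + fun y => ‖k y‖ₑ) :=
    condLExp_mono <| ae_of_all _ fun y => enorm_add_le _ _
  have a := condLExp_add_left (mΩ := A) (P := μ) (X := fun y => ‖g y‖ₑ)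
    (fun y => ‖k y‖ₑ) hg.1.enorm
  filter_upwards [m, a, hg.2, hk.2] with x h1 h2 h3 h4
  refine h1.trans_lt ?_
  rw [h2]
  exact ENNReal.add_lt_top.2 ⟨h3, h4⟩

theorem Conditionable.const_mul (c : ℂ) {g : X → ℂ} (hg : Conditionable A μ g) :
    Conditionable A μ (fun x => c * g x) := by
  refine ⟨hg.1.const_mul c, ?_⟩
  have s := condLExp_smul' (mΩ := A) (P := μ) (fun y => ‖g y‖ₑ) (c := ‖c‖ₑ) enorm_ne_top
  have e : (‖c‖ₑ • fun y => ‖g y‖ₑ) = fun y => ‖c * g y‖ₑ := by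
    funext y
    simp [enorm_mul]
  rw [e] at s
  filter_upwards [s, hg.2] with x h1 h2
  rw [h1]
  exact ENNReal.mul_lt_top enorm_lt_top h2

theorem condExpC_zero : condExpC A μ (fun _ => (0 : ℂ)) = fun _ => 0 := by
  funext x
  apply Complex.ext <;> simp [condExpC, condExpReal]

theorem condExpC_add {g k : X → ℂ} (hg : Conditionable A μ g) (hk : Conditionable A μ k) :
    condExpC A μ (fun x => g x + k x) =ᵐ[μ] fun x => condExpC A μ g x + condExpC A μ k x := by
  filter_upwards [condExpReal_add hg.re.1 hk.re.1 hg.re.2 hk.re.2,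
    condExpReal_add hg.im.1 hk.im.1 hg.im.2 hk.im.2] with x h1 h2
  apply Complex.ext
  · simpa [condExpC] using h1
  · simpa [condExpC] using h2

theorem condExpC_const_mul (c : ℂ) {g : X → ℂ} (hg : Conditionable A μ g) :
    condExpC A μ (fun x => c * g x) =ᵐ[μ] fun x => c * condExpC A μ g x := by
  have fin : ∀ (d : ℝ) (r : X → ℝ), (∀ᵐ x ∂μ, condLExp A μ (fun y => ‖r y‖ₑ) x < ∞) →
      ∀ᵐ x ∂μ, condLExp A μ (fun y => ‖d * r y‖ₑ) x < ∞ := by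
    intro d r hr
    have s := condLExp_smul' (mΩ := A) (P := μ) (fun y => ‖r y‖ₑ) (c := ‖d‖ₑ) enorm_ne_top
    have e : (‖d‖ₑ • fun y => ‖r y‖ₑ) = fun y => ‖d * r y‖ₑ := by
      funext y
      simp [enorm_mul]
    rw [e] at s
    filter_upwards [s, hr] with x h1 h2
    rw [h1]
    exact ENNReal.mul_lt_top enorm_lt_top h2
  have hr := hg.re
  have hi := hg.im
  have a1 := condExpReal_add (A := A) (hr.1.const_mul c.re) (hi.1.const_mul (-c.im))
    (fin c.re _ hr.2) (fin (-c.im) _ hi.2)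
  have a2 := condExpReal_add (A := A) (hi.1.const_mul c.re) (hr.1.const_mul c.im)
    (fin c.re _ hi.2) (fin c.im _ hr.2)
  filter_upwards [a1, a2, condExpReal_const_mul (A := A) (μ := μ) c.re (fun y => (g y).re),
    condExpReal_const_mul (A := A) (μ := μ) (-c.im) (fun y => (g y).im),
    condExpReal_const_mul (A := A) (μ := μ) c.re (fun y => (g y).im),
    condExpReal_const_mul (A := A) (μ := μ) c.im (fun y => (g y).re)] with x h1 h2 h3 h4 h5 h6
  rw [h3, h4] at h1
  rw [h5, h6] at h2
  apply Complex.ext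
  · simp only [condExpC, Complex.mul_re, sub_eq_add_neg, ← neg_mul]
    exact h1
  · simp only [condExpC, Complex.mul_im]
    exact h2

end CondExp

section WCT

variable {X : Type*}

/-- The natural domain of `M_w E M_u` in `L²(μ)`: those `f` for which `u f` is conditionable and
`w E(u f)` belongs to `L²(μ)`. -/
def wctDomain (A : MeasurableSpace X) {mX : MeasurableSpace X} (μ : Measure X) (w u : X →ₘ[μ] ℂ) :
    Submodule ℂ (Lp ℂ 2 μ) where
  carrier := {f | Conditionable A μ (fun x => u x * f x) ∧
    MemLp (fun x => w x * condExpC A μ (fun y => u y * f y) x) 2 μ}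
  zero_mem' := by
    have h : (fun _ : X => (0 : ℂ)) =ᵐ[μ] fun x => u x * (0 : Lp ℂ 2 μ) x := by
      filter_upwards [Lp.coeFn_zero ℂ 2 μ] with x hx
      refine (mul_eq_zero_of_right _ ?_).symm
      exact hx
    refine ⟨Conditionable.zero.congr h, ?_⟩
    refine (MemLp.zero' (p := 2) (μ := μ) (ε := ℂ)).ae_eq ?_
    filter_upwards [condExpC_congr (A := A) h] with x hx
    rw [← hx, condExpC_zero, mul_zero]
  add_mem' := by
    rintro f g ⟨hf1, hf2⟩ ⟨hg1, hg2⟩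
    have h : (fun x => u x * f x + u x * g x) =ᵐ[μ] fun x => u x * (f + g : Lp ℂ 2 μ) x := by
      filter_upwards [Lp.coeFn_add f g] with x hx
      rw [hx, Pi.add_apply, mul_add]
    refine ⟨(hf1.add hg1).congr h, (hf2.add hg2).ae_eq ?_⟩
    filter_upwards [condExpC_congr (A := A) h, condExpC_add hf1 hg1] with x h1 h2
    rw [← h1, h2, Pi.add_apply, mul_add]
  smul_mem' := by
    rintro c f ⟨hf1, hf2⟩
    have h : (fun x => c * (u x * f x)) =ᵐ[μ] fun x => u x * (c • f : Lp ℂ 2 μ) x := by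
      filter_upwards [Lp.coeFn_smul c f] with x hx
      rw [hx, Pi.smul_apply, smul_eq_mul]
      ring
    refine ⟨(hf1.const_mul c).congr h, (hf2.const_mul c).ae_eq ?_⟩
    filter_upwards [condExpC_congr (A := A) h, condExpC_const_mul c hf1] with x h1 h2
    rw [← h1, h2]
    ring

/-- The (in general unbounded) weighted conditional type operator `M_w E M_u : f ↦ w E(u f)` in
`L²(μ)`, on its natural domain. -/
def wct (A : MeasurableSpace X) {mX : MeasurableSpace X} (μ : Measure X) (w u : X →ₘ[μ] ℂ) :
    Lp ℂ 2 μ →ₗ.[ℂ] Lp ℂ 2 μ where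
  domain := wctDomain A μ w u
  toFun :=
    { toFun := fun f => f.2.2.toLp _
      map_add' := by
        intro f g
        have h : (fun x => u x * f.1 x + u x * g.1 x) =ᵐ[μ]
            fun x => u x * ((f + g : wctDomain A μ w u) : Lp ℂ 2 μ) x := by
          filter_upwards [Lp.coeFn_add f.1 g.1] with x hx
          rw [Submodule.coe_add, hx, Pi.add_apply, mul_add]
        rw [← MemLp.toLp_add]
        refine MemLp.toLp_congr _ _ ?_
        filter_upwards [condExpC_congr (A := A) h, condExpC_add f.2.1 g.2.1] with x h1 h2
        rw [← h1, h2, Pi.add_apply, mul_add]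
      map_smul' := by
        intro c f
        have h : (fun x => c * (u x * f.1 x)) =ᵐ[μ]
            fun x => u x * ((c • f : wctDomain A μ w u) : Lp ℂ 2 μ) x := by
          filter_upwards [Lp.coeFn_smul c f.1] with x hx
          rw [Submodule.coe_smul, hx, Pi.smul_apply, smul_eq_mul]
          ring
        rw [RingHom.id_apply, ← MemLp.toLp_const_smul]
        refine MemLp.toLp_congr _ _ ?_
        filter_upwards [condExpC_congr (A := A) h, condExpC_const_mul c f.2.1] with x h1 h2
        rw [← h1, h2, Pi.smul_apply, smul_eq_mul]
        ring }

/-- `h = 1 / (1 + E(|u|²) E(|w|²))`. -/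
def wctH (A : MeasurableSpace X) {mX : MeasurableSpace X} (μ : Measure X)
    (w u : X →ₘ[μ] ℂ) (x : X) : ℝ :=
  1 / (1 + (condSq A μ u x).toReal * (condSq A μ w x).toReal)

/-- `h₁ = E(|w|²) h`. -/
def wctH1 (A : MeasurableSpace X) {mX : MeasurableSpace X} (μ : Measure X)
    (w u : X →ₘ[μ] ℂ) (x : X) : ℝ :=
  (condSq A μ w x).toReal * wctH A μ w u x

/-- `h₂ = E(|u|²) h`. -/
def wctH2 (A : MeasurableSpace X) {mX : MeasurableSpace X} (μ : Measure X)
    (w u : X →ₘ[μ] ℂ) (x : X) : ℝ :=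
  (condSq A μ u x).toReal * wctH A μ w u x

end WCT

section CharacteristicMatrix

variable {H : Type*} [NormedAddCommGroup H] [InnerProductSpace ℂ H]

/-- The graph `{(x, T x) : x ∈ D(T)}` as a subspace of the Hilbert space sum `H ⊕ H`. -/
def graphSum (T : H →ₗ.[ℂ] H) : Submodule ℂ (WithLp 2 (H × H)) :=
  T.graph.comap (WithLp.linearEquiv 2 ℂ (H × H)).toLinearMap

/-- The characteristic matrix of `T`: the four entries `P i j` (row `i`, column `j`) of the
orthogonal projection `P` of `H ⊕ H` onto the graph of `T`, as bounded operators in `H`. -/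
def charMatrix (T : H →ₗ.[ℂ] H) [(graphSum T).HasOrthogonalProjection] :
    Matrix (Fin 2) (Fin 2) (H →L[ℂ] H) :=
  let e := WithLp.prodContinuousLinearEquiv 2 ℂ H H
  let P : H × H →L[ℂ] H × H :=
    e.toContinuousLinearMap ∘L (graphSum T).starProjection ∘L e.symm.toContinuousLinearMap
  let i₁ := ContinuousLinearMap.inl ℂ H H
  let i₂ := ContinuousLinearMap.inr ℂ H H
  let p₁ := ContinuousLinearMap.fst ℂ H H
  let p₂ := ContinuousLinearMap.snd ℂ H H
  !![p₁ ∘L P ∘L i₁, p₁ ∘L P ∘L i₂; p₂ ∘L P ∘L i₁, p₂ ∘L P ∘L i₂]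

end CharacteristicMatrix

end

/-! ### Conditional expectation of nonnegative functions, and two series estimates. -/

section CondLExp

variable {X : Type*} {A mX : MeasurableSpace X} {μ : Measure X}

/-! Once `E(|u|²)` and `E(|w|²)` are finite, the projection comes from a linear system over the
`A`-measurable functions. If `⟨s, p⟩ = ⟨r, Tp⟩` for all `p` in the domain (that is, `s = T*r`), then
`(s, -r)` is orthogonal to the graph. So `(f, 0)` is decomposed as `(f - s, r) + (s, -r)` by solving
`s = T*r`, `r = T(f - s)`, and `(0, g)` as `(s, g - r) + (-s, r)` by solving `s = T*r`, `g - r =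
Ts`. Here `T*` acts by `r ↦ ū E(w̄ r)`. Since `E` pulls out `A`-measurable factors, `E(|u|²)` and
`E(|w|²)` behave as scalars, and the solution is division by `1 + E(|u|²)E(|w|²)`. Conditional
Cauchy–Schwarz puts the solutions in `L²`. Exhibiting the decompositions yields the projection
directly, with no separate proof that `T` is closed (`hasOrthogonalProjection_graphSum`,
`exists_left_column`, `exists_right_column`).

Finiteness of `E(|u|²)` is a converse of Cauchy–Schwarz: were it infinite on a set of positive
measure, an Abel–Dini weight would give an `f` in `L²` with `uf` not conditionable
(`condSq_lt_top_of_conditionable_mul_of_measurable`).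

Finiteness of `E(|w|²)` can fail. But `‖Tf‖² = ∫ |E(uf)|² E(|w|²)` forces `E(uf) = 0` where `E(|w|²)
= ∞`, and density of the domain then forces `u = 0` there (`condSq_eq_zero_of_dense`). Hence `w` may
be cut off to the set where `E(|w|²) < ∞` without changing `T` (`wct_truncSq`). -/

theorem lintegral_mul_condLExp (hA : A ≤ mX) [SigmaFinite (μ.trim hA)] {c g : X → ℝ≥0∞}
    (hc : Measurable[A] c) (hg : AEMeasurable g μ) :
    ∫⁻ x, c x * condLExp A μ g x ∂μ = ∫⁻ x, c x * g x ∂μ := by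
  have hc' : Measurable c := hc.mono hA le_rfl
  -- The measures with densities `E(g)` and `g` agree on `A`, so they integrate `A`-measurable
  -- functions alike.
  have e : (μ.withDensity (condLExp A μ g)).trim hA = (μ.withDensity g).trim hA := by
    refine @Measure.ext X A _ _ fun s hs => ?_
    rw [trim_measurableSet_eq hA hs, trim_measurableSet_eq hA hs, withDensity_apply _ (hA s hs),
      withDensity_apply _ (hA s hs), setLIntegral_condLExp hA μ g hs]
  have h1 : ∫⁻ x, c x ∂(μ.withDensity (condLExp A μ g)) = ∫⁻ x, c x ∂(μ.withDensity g) := by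
    rw [← lintegral_trim hA hc, ← lintegral_trim hA hc, e]
  rw [lintegral_withDensity_eq_lintegral_mul₀ (by fun_prop) hc'.aemeasurable,
    lintegral_withDensity_eq_lintegral_mul₀ hg hc'.aemeasurable] at h1
  simpa [mul_comm] using h1

theorem condLExp_mul_left (hA : A ≤ mX) [SigmaFinite (μ.trim hA)] {c g : X → ℝ≥0∞}
    (hc : Measurable[A] c) (hg : AEMeasurable g μ) :
    condLExp A μ (fun x => c x * g x) =ᵐ[μ] fun x => c x * condLExp A μ g x := by
  refine (ae_eq_condLExp hA μ _ (hc.mul (measurable_condLExp A μ g)) fun s hs => ?_).symm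
  rw [← lintegral_indicator (hA s hs), ← lintegral_indicator (hA s hs)]
  have h := lintegral_mul_condLExp hA (hc.indicator hs) hg
  simp only [← Set.indicator_mul_left] at h
  exact h

/-- The discriminant argument for Cauchy–Schwarz. Only rational `t` are assumed, so that countably
many almost-everywhere inequalities can be used at a single point. -/
theorem sq_le_mul_of_forall_rat {a b z : ℝ≥0∞} (ha : a ≠ ∞) (hb : b ≠ ∞)
    (h : ∀ t : ℚ, 0 < t → 2 * z ≤ ENNReal.ofReal t * a + ENNReal.ofReal (t⁻¹ : ℝ) * b) :
    z ^ 2 ≤ a * b := by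
  have hz : z ≠ ∞ := by
    rintro rfl
    have := h 1 one_pos
    simp [ha, hb] at this
  lift a to NNReal using ha
  lift b to NNReal using hb
  lift z to NNReal using hz
  have h' : ∀ t : ℚ, 0 < t → 0 ≤ (a : ℝ) * ((t : ℝ) * t) + (-(2 * z)) * t + b := by
    intro t ht
    have ht' : (0 : ℝ) < t := by exact_mod_cast ht
    have h1 := ENNReal.toReal_mono (by finiteness) (h t ht)
    rw [ENNReal.toReal_add (by finiteness) (by finiteness), ENNReal.toReal_mul,
      ENNReal.toReal_mul, ENNReal.toReal_mul, ENNReal.toReal_ofReal ht'.le,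
      ENNReal.toReal_ofReal (inv_nonneg.2 ht'.le)] at h1
    simp only [ENNReal.toReal_ofNat, ENNReal.coe_toReal] at h1
    have h2 := mul_le_mul_of_nonneg_left h1 ht'.le
    have h3 : (t : ℝ) * (t * a + (t : ℝ)⁻¹ * b) = t * t * a + b := by field_simp
    rw [h3] at h2
    linarith
  -- For `t ≤ 0` every term is nonnegative; density of the rationals and continuity in `t` do the
  -- rest.
  have h'' : ∀ t : ℝ, 0 ≤ (a : ℝ) * (t * t) + (-(2 * z)) * t + b := by
    intro t
    refine Rat.denseRange_cast.induction_on (p := fun t : ℝ =>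
      0 ≤ (a : ℝ) * (t * t) + (-(2 * z)) * t + b) t
      (isClosed_le continuous_const (by fun_prop)) fun q => ?_
    rcases lt_or_ge 0 q with hq | hq
    · exact h' q hq
    · have hq' : (q : ℝ) ≤ 0 := by exact_mod_cast hq
      have h1 : 0 ≤ (a : ℝ) * (q * q) := mul_nonneg a.2 (mul_self_nonneg _)
      have h2 : 0 ≤ -(2 * z : ℝ) * q := by
        have := mul_nonneg z.2 (neg_nonneg.2 hq')
        simp only [NNReal.val_eq_coe] at this
        linarith
      exact add_nonneg (add_nonneg h1 h2) b.2
  have h3 := discrim_le_zero h''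
  rw [discrim] at h3
  have h4 : (z : ℝ) ^ 2 ≤ a * b := by linarith
  exact_mod_cast h4

/-- Conditional Cauchy–Schwarz: apply `E` to `2FG ≤ tF² + t⁻¹G²` for each positive rational `t`. -/
theorem condLExp_mul_sq_le {F G : X → ℝ≥0∞} (hF : AEMeasurable F μ)
    (hF' : ∀ᵐ x ∂μ, condLExp A μ (fun y => F y ^ 2) x < ∞)
    (hG' : ∀ᵐ x ∂μ, condLExp A μ (fun y => G y ^ 2) x < ∞) :
    ∀ᵐ x ∂μ, condLExp A μ (fun y => F y * G y) x ^ 2 ≤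
      condLExp A μ (fun y => F y ^ 2) x * condLExp A μ (fun y => G y ^ 2) x := by
  have key : ∀ᵐ x ∂μ, ∀ t : ℚ, 0 < t → 2 * condLExp A μ (fun y => F y * G y) x ≤
      ENNReal.ofReal t * condLExp A μ (fun y => F y ^ 2) x +
        ENNReal.ofReal (t⁻¹ : ℝ) * condLExp A μ (fun y => G y ^ 2) x := by
    refine ae_all_iff.2 fun t => ?_
    by_cases ht : 0 < t
    swap
    · exact ae_of_all _ fun x h => absurd h ht
    have ht' : (0 : ℝ) < t := by exact_mod_cast ht
    set r := ENNReal.ofReal t with hr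
    set s := ENNReal.ofReal (t⁻¹ : ℝ) with hs
    have hrs : r * s = 1 := by
      rw [hr, hs, ← ENNReal.ofReal_mul ht'.le, mul_inv_cancel₀ ht'.ne', ENNReal.ofReal_one]
    have hm : (2 : ℝ≥0∞) • (fun y => F y * G y) ≤ᵐ[μ]
        (r • fun y => F y ^ 2) + s • fun y => G y ^ 2 := ae_of_all _ fun y => by
      simp only [Pi.smul_apply, Pi.add_apply, smul_eq_mul]
      rcases eq_or_ne (F y) ∞ with hFy | hFy
      · have : r ≠ 0 := by simpa [hr] using ht
        simp [hFy, ENNReal.mul_top this]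
      rcases eq_or_ne (G y) ∞ with hGy | hGy
      · have : s ≠ 0 := by simpa [hs] using ht
        simp [hGy, ENNReal.mul_top this]
      have hr' : r ≠ ∞ := ENNReal.ofReal_ne_top
      have hs' : s ≠ ∞ := ENNReal.ofReal_ne_top
      generalize F y = p at *
      generalize G y = q at *
      lift p to NNReal using hFy
      lift q to NNReal using hGy
      clear_value r s
      lift r to NNReal using hr'
      lift s to NNReal using hs'
      norm_cast at hrs ⊢
      have hrs' : (r : ℝ) * s = 1 := by exact_mod_cast hrs
      rw [← NNReal.coe_le_coe]
      push_cast
      -- Since `rs = 1`, this square expands to `rp² - 2pq + sq²`.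
      have h0 : 0 ≤ (s : ℝ) * (r * p - q) ^ 2 := mul_nonneg s.2 (sq_nonneg _)
      have h1 : (s : ℝ) * (r * p - q) ^ 2 =
          (r * s) * r * p ^ 2 - 2 * (r * s) * (p * q) + s * q ^ 2 := by ring
      rw [h1, hrs'] at h0
      linarith
    have h1 := condLExp_mono (mΩ := A) hm
    have h2 := condLExp_smul' (mΩ := A) (P := μ) (fun y => F y * G y) (c := 2) (by simp)
    have h3 := condLExp_smul' (mΩ := A) (P := μ) (fun y => F y ^ 2) (c := r)
      ENNReal.ofReal_ne_top
    have h4 := condLExp_smul' (mΩ := A) (P := μ) (fun y => G y ^ 2) (c := s)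
      ENNReal.ofReal_ne_top
    have h5 := condLExp_add_left (mΩ := A) (P := μ) (X := r • fun y => F y ^ 2)
      (s • fun y => G y ^ 2) ((hF.pow_const 2).const_smul r)
    filter_upwards [h1, h2, h3, h4, h5] with x h1 h2 h3 h4 h5 _
    rw [h2, h5, Pi.add_apply, h3, h4] at h1
    simpa using h1
  filter_upwards [key, hF', hG'] with x h1 h2 h3
  exact sq_le_mul_of_forall_rat h2.ne h3.ne h1

theorem condLExp_lt_top_of_le {F G : X → ℝ≥0∞} (h : F ≤ᵐ[μ] G)
    (hG : ∀ᵐ x ∂μ, condLExp A μ G x < ∞) : ∀ᵐ x ∂μ, condLExp A μ F x < ∞ := by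
  filter_upwards [condLExp_mono (mΩ := A) h, hG] with x h1 h2 using h1.trans_lt h2

/-- With `Sₙ = 1 + d₀ + ⋯ + dₙ` and `S₋₁ = 1`, the `n`-th term is at most `1/Sₙ₋₁ - 1/Sₙ`, which
telescopes. -/
theorem tsum_div_sq_le_one (d : ℕ → ℝ≥0∞) (hd : ∀ n, d n ≠ ∞) :
    ∑' n, d n / (1 + ∑ k ∈ Finset.range (n + 1), d k) ^ 2 ≤ 1 := by
  lift d to ℕ → NNReal using hd
  refine ENNReal.tsum_le_of_sum_range_le fun N => ?_
  have key : ∀ N : ℕ, ∑ n ∈ Finset.range N, d n / (1 + ∑ k ∈ Finset.range (n + 1), d k) ^ 2 +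
      (1 + ∑ k ∈ Finset.range N, d k)⁻¹ ≤ 1 := by
    intro N
    induction N with
    | zero => simp
    | succ N ih =>
      refine le_trans ?_ ih
      rw [Finset.sum_range_succ, add_assoc]
      refine add_le_add le_rfl ?_
      rw [Finset.sum_range_succ _ N, ← add_assoc]
      have hS : 0 < 1 + ∑ k ∈ Finset.range N, d k := by positivity
      generalize 1 + ∑ k ∈ Finset.range N, d k = S at *
      generalize d N = e at *
      rw [← NNReal.coe_le_coe]
      push_cast
      have hS' : (0 : ℝ) < S := hS
      have he : (0 : ℝ) ≤ e := e.2
      have h1 : (S : ℝ)⁻¹ - (e / (S + e) ^ 2 + (S + e : ℝ)⁻¹) = e ^ 2 / (S * (S + e) ^ 2) := by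
        field_simp
        ring
      have h2 : (0 : ℝ) ≤ e ^ 2 / (S * (S + e) ^ 2) := by positivity
      linarith
  have h := (le_add_of_nonneg_right zero_le).trans (key N)
  have e : ∀ n, ((d n : ℝ≥0∞) / (1 + ∑ k ∈ Finset.range (n + 1), (d k : ℝ≥0∞)) ^ 2) =
      ((d n / (1 + ∑ k ∈ Finset.range (n + 1), d k) ^ 2 : NNReal) : ℝ≥0∞) := by
    intro n
    rw [ENNReal.coe_div (by positivity)]
    push_cast
    rfl
  simp only [e]
  exact_mod_cast h

/-- The Abel–Dini theorem: dividing a divergent series by its partial sums leaves it divergent. -/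
theorem tsum_lt_top_of_tsum_div_lt_top (d : ℕ → ℝ≥0∞) (hd : ∀ n, d n ≠ ∞)
    (h : ∑' n, d n / (1 + ∑ k ∈ Finset.range (n + 1), d k) < ∞) : ∑' n, d n < ∞ := by
  lift d to ℕ → NNReal using hd
  set S : ℕ → ℝ := fun N => 1 + ∑ k ∈ Finset.range N, (d k : ℝ) with hSdef
  have hS0 : ∀ N, 0 < S N := fun N => by positivity
  have hSm : Monotone S := fun m n hmn => by
    simp only [hSdef]
    gcongr
  have e : ∀ n, ((d n : ℝ≥0∞) / (1 + ∑ k ∈ Finset.range (n + 1), (d k : ℝ≥0∞))) =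
      ((d n / (1 + ∑ k ∈ Finset.range (n + 1), d k) : NNReal) : ℝ≥0∞) := by
    intro n
    rw [ENNReal.coe_div (by positivity)]
    push_cast
    rfl
  simp only [e] at h
  have hq := NNReal.summable_coe.2 (ENNReal.tsum_coe_ne_top_iff_summable.1 h.ne)
  have hq' : Summable fun n => (d n : ℝ) / S (n + 1) := by simpa [hSdef] using hq
  -- Beyond `k` the tail is below `1/2`. It dominates `(S m - S k) / S m`, whence `S m ≤ 2 S k`.
  obtain ⟨k, hk⟩ := (hq'.hasSum.tendsto_sum_nat.eventually
    (lt_mem_nhds (show ∑' n, (d n : ℝ) / S (n + 1) - 1 / 2 < ∑' n, (d n : ℝ) / S (n + 1) by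
      linarith))).exists
  have hq0 : ∀ n, 0 ≤ (d n : ℝ) / S (n + 1) := fun n => div_nonneg (d n).2 (hS0 _).le
  have bound : ∀ m, k ≤ m → S m ≤ 2 * S k := by
    intro m hkm
    have h1 : ∑ n ∈ Finset.Ico k m, (d n : ℝ) / S m ≤ ∑ n ∈ Finset.Ico k m, d n / S (n + 1) := by
      refine Finset.sum_le_sum fun n hn => ?_
      exact div_le_div_of_nonneg_left (d n).2 (hS0 _) (hSm (Finset.mem_Ico.1 hn).2)
    have h2 := hq'.sum_le_tsum (Finset.range m) fun n _ => hq0 n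
    have h3 := Finset.sum_range_add_sum_Ico (fun n => (d n : ℝ) / S (n + 1)) hkm
    have h4 := Finset.sum_range_add_sum_Ico (fun n => (d n : ℝ)) hkm
    rw [← Finset.sum_div] at h1
    have h5 : S m = S k + ∑ n ∈ Finset.Ico k m, (d n : ℝ) := by
      simp only [hSdef]
      linarith
    have h6 : (∑ n ∈ Finset.Ico k m, (d n : ℝ)) / S m ≤ 1 / 2 := by linarith
    rw [div_le_iff₀ (hS0 m)] at h6
    linarith
  have hsum : Summable fun n => (d n : ℝ) := by
    refine summable_of_sum_range_le (c := 2 * S k) (fun n => (d n).2) fun m => ?_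
    have h1 := bound (max k m) (le_max_left _ _)
    have h2 := hSm (le_max_right k m)
    have h3 : ∑ n ∈ Finset.range m, (d n : ℝ) = S m - 1 := by simp [hSdef]
    linarith
  exact (ENNReal.tsum_coe_ne_top_iff_summable.2 (NNReal.summable_coe.1 hsum)).lt_top

end CondLExp

/-! ### Complex conditional expectation: locality, pull-out, integrals and `L²` bounds. -/

section CondExpC

variable {X : Type*} {A mX : MeasurableSpace X} {μ : Measure X}

/-- Pull the indicator of `s` out of the conditional expectation. -/
theorem condLExp_congr_on (hA : A ≤ mX) [SigmaFinite (μ.trim hA)] {s : Set X}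
    (hs : MeasurableSet[A] s) {F G : X → ℝ≥0∞} (hF : AEMeasurable F μ) (hG : AEMeasurable G μ)
    (h : ∀ᵐ x ∂μ, x ∈ s → F x = G x) :
    ∀ᵐ x ∂μ, x ∈ s → condLExp A μ F x = condLExp A μ G x := by
  have hc : Measurable[A] (s.indicator fun _ => (1 : ℝ≥0∞)) := measurable_const.indicator hs
  have e : (fun x => s.indicator (fun _ => (1 : ℝ≥0∞)) x * F x) =ᵐ[μ]
      fun x => s.indicator (fun _ => (1 : ℝ≥0∞)) x * G x := by
    filter_upwards [h] with x hx
    by_cases hxs : x ∈ s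
    · simp [hxs, hx hxs]
    · simp [hxs]
  filter_upwards [condLExp_mul_left hA hc hF, condLExp_mul_left hA hc hG,
    condLExp_congr_ae (mΩ := A) e] with x h1 h2 h3 hxs
  rw [h1, h2] at h3
  simpa [hxs] using h3

theorem condExpReal_congr_on (hA : A ≤ mX) [SigmaFinite (μ.trim hA)] {s : Set X}
    (hs : MeasurableSet[A] s) {g k : X → ℝ} (hg : AEMeasurable g μ) (hk : AEMeasurable k μ)
    (h : ∀ᵐ x ∂μ, x ∈ s → g x = k x) :
    ∀ᵐ x ∂μ, x ∈ s → condExpReal A μ g x = condExpReal A μ k x := by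
  have h1 := condLExp_congr_on hA hs hg.ennreal_ofReal hk.ennreal_ofReal
    (h.mono fun x hx hxs => by rw [hx hxs])
  have h2 := condLExp_congr_on hA hs hg.neg.ennreal_ofReal hk.neg.ennreal_ofReal
    (h.mono fun x hx hxs => by simp only [Pi.neg_apply, hx hxs])
  filter_upwards [h1, h2] with x h1 h2 hxs
  have h2' := h2 hxs
  simp only [Pi.neg_apply] at h2'
  simp only [condExpReal, h1 hxs]
  rw [h2']

theorem condExpC_congr_on (hA : A ≤ mX) [SigmaFinite (μ.trim hA)] {s : Set X}
    (hs : MeasurableSet[A] s) {g k : X → ℂ} (hg : AEMeasurable g μ) (hk : AEMeasurable k μ)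
    (h : ∀ᵐ x ∂μ, x ∈ s → g x = k x) :
    ∀ᵐ x ∂μ, x ∈ s → condExpC A μ g x = condExpC A μ k x := by
  filter_upwards [condExpReal_congr_on hA hs (Complex.measurable_re.comp_aemeasurable hg)
      (Complex.measurable_re.comp_aemeasurable hk) (h.mono fun x hx hxs => by simp [hx hxs]),
    condExpReal_congr_on hA hs (Complex.measurable_im.comp_aemeasurable hg)
      (Complex.measurable_im.comp_aemeasurable hk) (h.mono fun x hx hxs => by simp [hx hxs])]
    with x h1 h2 hxs
  exact Complex.ext (h1 hxs) (h2 hxs)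

theorem measurable_condExpReal (g : X → ℝ) : Measurable[A] (condExpReal A μ g) := by
  have h1 := measurable_condLExp A μ fun y => ENNReal.ofReal (g y)
  have h2 := measurable_condLExp A μ fun y => ENNReal.ofReal (-g y)
  exact h1.ennreal_toReal.sub h2.ennreal_toReal

theorem measurable_condExpC (g : X → ℂ) : Measurable[A] (condExpC A μ g) := by
  have h1 := measurable_condExpReal (A := A) (μ := μ) fun y => (g y).re
  have h2 := measurable_condExpReal (A := A) (μ := μ) fun y => (g y).im
  exact Complex.measurableEquivRealProd.symm.measurable.comp (h1.prodMk h2)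

theorem measurable_condSq (g : X → ℂ) : Measurable[A] (condSq A μ g) :=
  measurable_condLExp A μ _

theorem condExpReal_neg (g : X → ℝ) (x : X) :
    condExpReal A μ (fun y => -g y) x = -condExpReal A μ g x := by
  simp [condExpReal]

theorem condExpC_star (g : X → ℂ) (x : X) :
    condExpC A μ (fun y => star (g y)) x = star (condExpC A μ g x) := by
  apply Complex.ext
  · simp [condExpC]
  · simp [condExpC, condExpReal_neg]

theorem condSq_star (g : X → ℂ) : condSq A μ (fun y => star (g y)) = condSq A μ g := by
  simp [condSq]

theorem Conditionable.star {g : X → ℂ} (hg : Conditionable A μ g) :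
    Conditionable A μ (fun x => star (g x)) :=
  ⟨continuous_star.measurable.comp_aemeasurable hg.1, by simpa using hg.2⟩

theorem condLExp_enorm_mul_lt_top (hA : A ≤ mX) [SigmaFinite (μ.trim hA)] {E : Type*}
    [NormedRing E] [NormMulClass E] [MeasurableSpace E] [OpensMeasurableSpace E] {c g : X → E}
    (hc : Measurable[A] c) (hg : AEMeasurable g μ)
    (h : ∀ᵐ x ∂μ, condLExp A μ (fun y => ‖g y‖ₑ) x < ∞) :
    ∀ᵐ x ∂μ, condLExp A μ (fun y => ‖c y * g y‖ₑ) x < ∞ := by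
  simp only [enorm_mul]
  filter_upwards [condLExp_mul_left hA (measurable_enorm.comp hc) hg.enorm, h] with x h1 h2
  exact h1.trans_lt (ENNReal.mul_lt_top enorm_lt_top h2)

theorem Conditionable.mul_left (hA : A ≤ mX) [SigmaFinite (μ.trim hA)] {c g : X → ℂ}
    (hc : Measurable[A] c) (hg : Conditionable A μ g) :
    Conditionable A μ (fun x => c x * g x) :=
  ⟨(hc.mono hA le_rfl).aemeasurable.mul hg.1, condLExp_enorm_mul_lt_top hA hc hg.1 hg.2⟩

theorem condLExp_ofReal_lt_top {g : X → ℝ}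
    (h : ∀ᵐ x ∂μ, condLExp A μ (fun y => ‖g y‖ₑ) x < ∞) :
    ∀ᵐ x ∂μ, condLExp A μ (fun y => ENNReal.ofReal (g y)) x < ∞ ∧
      condLExp A μ (fun y => ENNReal.ofReal (-g y)) x < ∞ := by
  have m1 := condLExp_lt_top_of_le (F := fun y => ENNReal.ofReal (g y))
    (ae_of_all _ fun y => Real.ofReal_le_enorm _) h
  have m2 := condLExp_lt_top_of_le (F := fun y => ENNReal.ofReal (-g y))
    (ae_of_all _ fun y => (Real.ofReal_le_enorm _).trans_eq (enorm_neg _)) h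
  exact m1.and m2

theorem ofReal_mul_eq_add (c g : ℝ) : ENNReal.ofReal (c * g) =
    ENNReal.ofReal c * ENNReal.ofReal g + ENNReal.ofReal (-c) * ENNReal.ofReal (-g) := by
  rcases le_total 0 c with hc | hc
  · rw [ENNReal.ofReal_mul hc, ENNReal.ofReal_of_nonpos (neg_nonpos.2 hc), zero_mul, add_zero]
  · rw [← neg_mul_neg, ENNReal.ofReal_mul (neg_nonneg.2 hc), ENNReal.ofReal_of_nonpos hc,
      zero_mul, zero_add]

/-- The positive part of `cg` is `c⁺g⁺ + c⁻g⁻` and the negative part is `c⁺g⁻ + c⁻g⁺`; the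
nonnegative pull-out applies to each product. -/
theorem condExpReal_mul_left (hA : A ≤ mX) [SigmaFinite (μ.trim hA)] {c g : X → ℝ}
    (hc : Measurable[A] c) (hg : AEMeasurable g μ)
    (h : ∀ᵐ x ∂μ, condLExp A μ (fun y => ‖g y‖ₑ) x < ∞) :
    condExpReal A μ (fun x => c x * g x) =ᵐ[μ] fun x => c x * condExpReal A μ g x := by
  have key : ∀ r : X → ℝ, AEMeasurable r μ →
      condLExp A μ (fun y => ENNReal.ofReal (c y * r y)) =ᵐ[μ] fun x =>
        ENNReal.ofReal (c x) * condLExp A μ (fun y => ENNReal.ofReal (r y)) x +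
        ENNReal.ofReal (-c x) * condLExp A μ (fun y => ENNReal.ofReal (-r y)) x := by
    intro r hr
    simp only [ofReal_mul_eq_add]
    have hc1 := hc.ennreal_ofReal
    have hc2 := hc.neg.ennreal_ofReal
    filter_upwards [condLExp_add_left (mΩ := A) (P := μ)
        (X := fun y => ENNReal.ofReal (c y) * ENNReal.ofReal (r y))
        (fun y => ENNReal.ofReal (-c y) * ENNReal.ofReal (-r y))
        ((hc1.mono hA le_rfl).aemeasurable.mul hr.ennreal_ofReal),
      condLExp_mul_left hA hc1 hr.ennreal_ofReal,
      condLExp_mul_left hA hc2 hr.neg.ennreal_ofReal] with x h1 h2 h3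
    simp only [Pi.neg_apply] at h3
    rw [← h2, ← h3, ← Pi.add_apply, ← h1]
    rfl
  have k1 := key g hg
  have k2 := key (fun y => -g y) hg.neg
  simp only [neg_neg, mul_neg] at k2
  filter_upwards [k1, k2, condLExp_ofReal_lt_top h] with x h1 h2 h3
  simp only [condExpReal, h1, h2]
  rw [ENNReal.toReal_add (by finiteness [h3.1, h3.2]) (by finiteness [h3.1, h3.2]),
    ENNReal.toReal_add (by finiteness [h3.1, h3.2]) (by finiteness [h3.1, h3.2])]
  simp only [ENNReal.toReal_mul, ENNReal.toReal_ofReal']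
  have e : c x = max (c x) 0 - max (-c x) 0 := by
    rcases le_total 0 (c x) with h | h <;> simp [h]
  generalize max (c x) 0 = p at *
  generalize max (-c x) 0 = q at *
  rw [e]
  ring

theorem condExpC_mul_left (hA : A ≤ mX) [SigmaFinite (μ.trim hA)] {c g : X → ℂ}
    (hc : Measurable[A] c) (hg : Conditionable A μ g) :
    condExpC A μ (fun x => c x * g x) =ᵐ[μ] fun x => c x * condExpC A μ g x := by
  have hr := hg.re
  have hi := hg.im
  have cr : Measurable[A] fun x => (c x).re := Complex.measurable_re.comp hc
  have ci : Measurable[A] fun x => (c x).im := Complex.measurable_im.comp hc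
  have cn : Measurable[A] fun x => -(c x).im := ci.neg
  have cr' := (cr.mono hA le_rfl).aemeasurable (μ := μ)
  have ci' := (ci.mono hA le_rfl).aemeasurable (μ := μ)
  have cn' := (cn.mono hA le_rfl).aemeasurable (μ := μ)
  have a1 := condExpReal_add (A := A) (cr'.mul hr.1) (cn'.mul hi.1)
    (condLExp_enorm_mul_lt_top hA cr hr.1 hr.2) (condLExp_enorm_mul_lt_top hA cn hi.1 hi.2)
  have a2 := condExpReal_add (A := A) (cr'.mul hi.1) (ci'.mul hr.1)
    (condLExp_enorm_mul_lt_top hA cr hi.1 hi.2) (condLExp_enorm_mul_lt_top hA ci hr.1 hr.2)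
  filter_upwards [a1, a2, condExpReal_mul_left hA cr hr.1 hr.2,
    condExpReal_mul_left hA cn hi.1 hi.2, condExpReal_mul_left hA cr hi.1 hi.2,
    condExpReal_mul_left hA ci hr.1 hr.2] with x h1 h2 h3 h4 h5 h6
  replace h1 := h1.trans (congrArg₂ (· + ·) h3 h4)
  replace h2 := h2.trans (congrArg₂ (· + ·) h5 h6)
  apply Complex.ext
  · simp only [condExpC, Complex.mul_re, sub_eq_add_neg, ← neg_mul]
    exact h1
  · simp only [condExpC, Complex.mul_im]
    exact h2

theorem integral_condExpReal (hA : A ≤ mX) [SigmaFinite (μ.trim hA)] {g : X → ℝ}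
    (hg : Integrable g μ) :
    Integrable (condExpReal A μ g) μ ∧ ∫ x, condExpReal A μ g x ∂μ = ∫ x, g x ∂μ := by
  have h1 : ∫⁻ x, ENNReal.ofReal (g x) ∂μ ≠ ∞ := hg.lintegral_lt_top.ne
  have h2 : ∫⁻ x, ENNReal.ofReal (-g x) ∂μ ≠ ∞ := hg.neg.lintegral_lt_top.ne
  have m1 := measurable_condLExp' A μ fun x => ENNReal.ofReal (g x)
  have m2 := measurable_condLExp' A μ fun x => ENNReal.ofReal (-g x)
  have e1 := lintegral_condLExp hA μ fun x => ENNReal.ofReal (g x)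
  have e2 := lintegral_condLExp hA μ fun x => ENNReal.ofReal (-g x)
  have i1 := integrable_toReal_of_lintegral_ne_top m1.aemeasurable (e1 ▸ h1)
  have i2 := integrable_toReal_of_lintegral_ne_top m2.aemeasurable (e2 ▸ h2)
  refine ⟨i1.sub i2, ?_⟩
  simp only [condExpReal]
  rw [integral_sub i1 i2, integral_toReal m1.aemeasurable (condLExp_lt_top h1),
    integral_toReal m2.aemeasurable (condLExp_lt_top h2), e1, e2,
    integral_eq_lintegral_pos_part_sub_lintegral_neg_part hg]

theorem integral_condExpC (hA : A ≤ mX) [SigmaFinite (μ.trim hA)] {g : X → ℂ}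
    (hg : Integrable g μ) : ∫ x, condExpC A μ g x ∂μ = ∫ x, g x ∂μ := by
  obtain ⟨i1, e1⟩ := integral_condExpReal hA hg.re
  obtain ⟨i2, e2⟩ := integral_condExpReal hA hg.im
  have i : Integrable (condExpC A μ g) μ := by
    have := i1.ofReal (𝕜 := ℂ).add (i2.ofReal (𝕜 := ℂ).mul_const Complex.I)
    refine this.congr (ae_of_all _ fun x => ?_)
    exact Complex.re_add_im (condExpC A μ g x)
  rw [← integral_re_add_im i, ← integral_re_add_im hg]
  exact congrArg₂ (fun a b : ℝ => (a : ℂ) + b * Complex.I) e1 e2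

theorem enorm_condExpReal_le {g : X → ℝ} :
    ∀ᵐ x ∂μ, ‖condExpReal A μ g x‖ₑ ≤ condLExp A μ (fun y => ‖g y‖ₑ) x := by
  have m1 : condLExp A μ (fun y => ENNReal.ofReal (g y)) ≤ᵐ[μ] condLExp A μ (fun y => ‖g y‖ₑ) :=
    condLExp_mono (ae_of_all _ fun y => Real.ofReal_le_enorm _)
  have m2 : condLExp A μ (fun y => ENNReal.ofReal (-g y)) ≤ᵐ[μ] condLExp A μ (fun y => ‖g y‖ₑ) :=
    condLExp_mono (ae_of_all _ fun y => (Real.ofReal_le_enorm _).trans_eq (enorm_neg _))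
  filter_upwards [m1, m2] with x h1 h2
  rcases eq_or_ne (condLExp A μ (fun y => ‖g y‖ₑ) x) ∞ with h | h
  · rw [h]; exact le_top
  rw [← ofReal_norm, ENNReal.ofReal_le_iff_le_toReal h, Real.norm_eq_abs, condExpReal]
  have h1' := ENNReal.toReal_mono h h1
  have h2' := ENNReal.toReal_mono h h2
  exact abs_sub_le_of_nonneg_of_le ENNReal.toReal_nonneg h1' ENNReal.toReal_nonneg h2'

/-- The factor 2 comes from bounding real and imaginary parts separately. Only finiteness is needed
later, so the sharp constant is not sought. -/
theorem enorm_condExpC_le {g : X → ℂ} :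
    ∀ᵐ x ∂μ, ‖condExpC A μ g x‖ₑ ≤ 2 * condLExp A μ (fun y => ‖g y‖ₑ) x := by
  have m1 : condLExp A μ (fun y => ‖(g y).re‖ₑ) ≤ᵐ[μ] condLExp A μ (fun y => ‖g y‖ₑ) :=
    condLExp_mono <| ae_of_all _ fun y => by
      simpa only [← ofReal_norm, Real.norm_eq_abs] using
        ENNReal.ofReal_le_ofReal (Complex.abs_re_le_norm _)
  have m2 : condLExp A μ (fun y => ‖(g y).im‖ₑ) ≤ᵐ[μ] condLExp A μ (fun y => ‖g y‖ₑ) :=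
    condLExp_mono <| ae_of_all _ fun y => by
      simpa only [← ofReal_norm, Real.norm_eq_abs] using
        ENNReal.ofReal_le_ofReal (Complex.abs_im_le_norm _)
  filter_upwards [m1, m2, enorm_condExpReal_le (A := A) (μ := μ) (g := fun y => (g y).re),
    enorm_condExpReal_le (A := A) (μ := μ) (g := fun y => (g y).im)] with x h1 h2 h3 h4
  rw [two_mul]
  refine le_trans ?_ (add_le_add (h3.trans h1) (h4.trans h2))
  rw [← ofReal_norm, ← ofReal_norm, ← ofReal_norm,
    ← ENNReal.ofReal_add (norm_nonneg _) (norm_nonneg _)]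
  exact ENNReal.ofReal_le_ofReal (Complex.norm_le_abs_re_add_abs_im _)

/-- No finiteness is needed, because both sides send the value `∞` to `0`. -/
theorem condExpC_star_mul_self (v : X → ℂ) (x : X) :
    condExpC A μ (fun y => star (v y) * v y) x = ((condSq A μ v x).toReal : ℂ) := by
  have h1 : (fun y => star (v y) * v y) = fun y => ((‖v y‖ ^ 2 : ℝ) : ℂ) := by
    funext y
    rw [Complex.star_def, Complex.conj_mul']
    norm_cast
  have h3 : ∀ y, ENNReal.ofReal (‖v y‖ ^ 2) = ‖v y‖ₑ ^ 2 := fun y => by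
    rw [ENNReal.ofReal_pow (norm_nonneg _), ofReal_norm]
  have h4 : ∀ y, ENNReal.ofReal (-‖v y‖ ^ 2) = 0 := fun y =>
    ENNReal.ofReal_of_nonpos (by simp)
  have h5 : condLExp A μ (fun _ => 0) = 0 := condLExp_zero μ
  rw [h1]
  apply Complex.ext
  · simp only [condExpC, condExpReal, Complex.ofReal_re, h3, h4, h5, condSq]
    simp
  · simp only [condExpC, condExpReal, Complex.ofReal_im]
    simp

theorem condSq_lt_top_of_memLp {f : X → ℂ} (hf : MemLp f 2 μ) :
    ∀ᵐ x ∂μ, condSq A μ f x < ∞ := by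
  refine condLExp_lt_top ?_
  have := (lintegral_rpow_enorm_lt_top_of_eLpNorm_lt_top two_ne_zero ENNReal.ofNat_ne_top hf.2).ne
  simpa using this

theorem memLp_two_iff_lintegral {f : X → ℂ} (hf : AEMeasurable f μ) :
    MemLp f 2 μ ↔ ∫⁻ x, ‖f x‖ₑ ^ 2 ∂μ < ∞ := by
  rw [MemLp, eLpNorm_lt_top_iff_lintegral_rpow_enorm_lt_top two_ne_zero ENNReal.ofNat_ne_top]
  simp [hf.aestronglyMeasurable]

theorem conditionable_mul {v f : X → ℂ} (hv : AEMeasurable v μ)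
    (hv' : ∀ᵐ x ∂μ, condSq A μ v x < ∞) (hf : MemLp f 2 μ) :
    Conditionable A μ (fun x => v x * f x) := by
  refine ⟨hv.mul hf.1.aemeasurable, ?_⟩
  have hf' := condSq_lt_top_of_memLp (A := A) hf
  have := condLExp_mul_sq_le (A := A) (G := fun x => ‖f x‖ₑ) hv.enorm hv' hf'
  simp only [enorm_mul]
  filter_upwards [this, hv', hf'] with x h1 h2 h3
  have h4 := h1.trans_lt (ENNReal.mul_lt_top h2 h3)
  simpa using h4

theorem enorm_condExpC_mul_sq_le {v f : X → ℂ} (hv : AEMeasurable v μ)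
    (hv' : ∀ᵐ x ∂μ, condSq A μ v x < ∞) (hf : MemLp f 2 μ) :
    ∀ᵐ x ∂μ, ‖condExpC A μ (fun y => v y * f y) x‖ₑ ^ 2 ≤
      4 * (condSq A μ v x * condSq A μ f x) := by
  have hf' := condSq_lt_top_of_memLp (A := A) hf
  have h1 := condLExp_mul_sq_le (A := A) (G := fun x => ‖f x‖ₑ) hv.enorm hv' hf'
  simp only [← enorm_mul] at h1
  filter_upwards [h1, enorm_condExpC_le (A := A) (μ := μ) (g := fun y => v y * f y)] with x h1 h2
  calc _ ≤ (2 * condLExp A μ (fun y => ‖v y * f y‖ₑ) x) ^ 2 := by gcongr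
    _ = 4 * condLExp A μ (fun y => ‖v y * f y‖ₑ) x ^ 2 := by rw [mul_pow]; norm_num
    _ ≤ _ := by gcongr; exact h1

theorem lintegral_enorm_sq_mul (hA : A ≤ mX) [SigmaFinite (μ.trim hA)] {c v : X → ℂ}
    (hc : Measurable[A] c) (hv : AEMeasurable v μ) :
    ∫⁻ x, ‖c x * v x‖ₑ ^ 2 ∂μ = ∫⁻ x, ‖c x‖ₑ ^ 2 * condSq A μ v x ∂μ := by
  have h := lintegral_mul_condLExp hA ((measurable_enorm.comp hc).pow_const 2) (hv.enorm.pow_const 2)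
  simp only [enorm_mul, mul_pow, condSq]
  exact h.symm

/-- Under the integral `|z|²` may be replaced by `E(|z|²)`. Cauchy–Schwarz and the bound on `b` then
leave `4 E(|f|²)`, whose integral is `4‖f‖²`. -/
theorem memLp_mul_condExpC_mul (hA : A ≤ mX) [SigmaFinite (μ.trim hA)] {v z f : X → ℂ}
    {b : X → ℝ} (hb : Measurable[A] b) (hv : AEMeasurable v μ) (hz : AEMeasurable z μ)
    (hv' : ∀ᵐ x ∂μ, condSq A μ v x < ∞) (hf : MemLp f 2 μ)
    (hle : ∀ᵐ x ∂μ, ‖b x‖ₑ ^ 2 * (condSq A μ v x * condSq A μ z x) ≤ 1) :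
    MemLp (fun x => b x * condExpC A μ (fun y => v y * f y) x * z x) 2 μ := by
  have hb' : Measurable[A] fun x => (b x : ℂ) := Complex.measurable_ofReal.comp hb
  have hc := hb'.mul (measurable_condExpC (A := A) (μ := μ) fun y => v y * f y)
  refine (memLp_two_iff_lintegral ((hc.mono hA le_rfl).aemeasurable.mul hz)).2 ?_
  refine (lintegral_enorm_sq_mul hA hc hz).trans_lt ?_
  have hfin : ∫⁻ x, 4 * condSq A μ f x ∂μ < ∞ := by
    rw [lintegral_const_mul' _ _ (by simp), condSq, lintegral_condLExp hA]
    exact ENNReal.mul_lt_top (by simp) ((memLp_two_iff_lintegral hf.1.aemeasurable).1 hf)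
  refine (lintegral_mono_ae ?_).trans_lt hfin
  filter_upwards [enorm_condExpC_mul_sq_le hv hv' hf, hle] with x h1 h2
  simp only [Pi.mul_apply, enorm_mul, mul_pow]
  have e : ‖(b x : ℂ)‖ₑ = ‖b x‖ₑ := by simp [← ofReal_norm]
  rw [e]
  calc _ ≤ ‖b x‖ₑ ^ 2 * (4 * (condSq A μ v x * condSq A μ f x)) * condSq A μ z x := by gcongr
    _ = ‖b x‖ₑ ^ 2 * (condSq A μ v x * condSq A μ z x) * (4 * condSq A μ f x) := by ring
    _ ≤ 1 * (4 * condSq A μ f x) := by gcongr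
    _ = _ := one_mul _

end CondExpC

/-! ### Finiteness of `E(|u|²)`. -/

section Conditionable

variable {X : Type*} {A mX : MeasurableSpace X} {μ : Measure X}

theorem condLExp_tsum_apply {F : ℕ → X → ℝ≥0∞} (hF : ∀ n, AEMeasurable (F n) μ) :
    condLExp A μ (fun x => ∑' n, F n x) =ᵐ[μ] fun x => ∑' n, condLExp A μ (F n) x := by
  have h := condLExp_tsum (P := μ) A hF
  have e1 : (∑' n, F n) = fun x => ∑' n, F n x := by funext x; exact ENNReal.tsum_apply
  have e2 : (∑' n, condLExp A μ (F n)) = fun x => ∑' n, condLExp A μ (F n) x := by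
    funext x; exact ENNReal.tsum_apply
  rwa [e1, e2] at h

/-- Slice `X` by the integer part of `|u|`, let `Dₙ` be the contribution of the `n`-th slice to
`E(|u|²)` and `Sₙ = 1 + D₀ + ⋯ + Dₙ`. On a set `B` in `A` of finite measure test with `f = |u| / Sₙ`
on slice `n`. Then `E(|f|²) = ∑ Dₙ/Sₙ² ≤ 1`, so `f` is in `L²`, while `E(|uf|) = ∑ Dₙ/Sₙ` is finite
by hypothesis. Abel–Dini gives `∑ Dₙ < ∞`. -/
theorem condSq_lt_top_of_conditionable_mul_of_measurable (hA : A ≤ mX) [SigmaFinite (μ.trim hA)]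
    {u : X → ℂ} (hu : Measurable u)
    (huf : ∀ f : X → ℂ, MemLp f 2 μ → Conditionable A μ (fun x => u x * f x)) :
    ∀ᵐ x ∂μ, condSq A μ u x < ∞ := by
  let Y : ℕ → Set X := fun n => {x | ⌊‖u x‖⌋₊ = n}
  have hY : ∀ n, MeasurableSet (Y n) := fun n =>
    (Nat.measurable_floor.comp hu.norm) (measurableSet_singleton n)
  let G : ℕ → X → ℝ≥0∞ := fun n => (Y n).indicator fun x => ‖u x‖ₑ ^ 2
  have hG : ∀ n, AEMeasurable (G n) μ := fun n =>
    ((hu.enorm.pow_const 2).indicator (hY n)).aemeasurable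
  have hGsum : ∀ (a : ℕ → ℝ≥0∞) (x : X), ∑' n, a n * G n x = a ⌊‖u x‖⌋₊ * ‖u x‖ₑ ^ 2 := by
    intro a x
    rw [tsum_eq_single ⌊‖u x‖⌋₊]
    · simp [G, Y]
    · intro n hn
      have : x ∉ Y n := fun h => hn h.symm
      simp [G, this]
  let D : ℕ → X → ℝ≥0∞ := fun n => condLExp A μ (G n)
  have hD : ∀ n, Measurable[A] (D n) := fun n => measurable_condLExp A μ _
  have hDtop : ∀ᵐ x ∂μ, ∀ n, D n x ≠ ∞ := by
    refine ae_all_iff.2 fun n => ?_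
    have hle : G n ≤ᵐ[μ] fun _ => ((n : ℝ≥0∞) + 1) ^ 2 := ae_of_all _ fun x => by
      by_cases hx : x ∈ Y n
      · have h1 : ‖u x‖ₑ ≤ (n : ℝ≥0∞) + 1 := by
          have h2 := (Nat.lt_floor_add_one ‖u x‖).le
          rw [show ⌊‖u x‖⌋₊ = n from hx] at h2
          rw [← ofReal_norm]
          refine (ENNReal.ofReal_le_ofReal h2).trans_eq ?_
          rw [ENNReal.ofReal_add (by positivity) zero_le_one, ENNReal.ofReal_natCast,
            ENNReal.ofReal_one]
        simp only [G, Set.indicator_of_mem hx]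
        gcongr
      · simp [G, hx]
    have h := condLExp_mono (mΩ := A) hle
    rw [condLExp_const hA] at h
    filter_upwards [h] with x hx
    exact (hx.trans_lt (by finiteness)).ne
  have hsum : condSq A μ u =ᵐ[μ] fun x => ∑' n, D n x := by
    have h := condLExp_tsum_apply (A := A) hG
    have e : (fun x => ∑' n, G n x) = fun x => ‖u x‖ₑ ^ 2 := by
      funext x
      simpa using hGsum (fun _ => 1) x
    rwa [e] at h
  let S : ℕ → X → ℝ≥0∞ := fun n x => 1 + ∑ k ∈ Finset.range (n + 1), D k x
  have hS : ∀ n, Measurable[A] (S n) := fun n =>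
    measurable_const.add (Finset.measurable_sum _ fun k _ => hD k)
  have main : ∀ i, ∀ᵐ x ∂μ, x ∈ spanningSets (μ.trim hA) i → ∑' n, D n x < ∞ := by
    intro i
    set B := spanningSets (μ.trim hA) i with hB
    have hBm : MeasurableSet[A] B := measurableSet_spanningSets (μ.trim hA) i
    have hBfin : μ B < ∞ := by
      rw [← trim_measurableSet_eq hA hBm]
      exact measure_spanningSets_lt_top (μ.trim hA) i
    let b : X → ℝ≥0∞ := B.indicator fun _ => 1
    have hb : Measurable[A] b := measurable_const.indicator hBm
    have hb1 : ∀ x, b x ≤ 1 := fun x => Set.indicator_le_self' (fun _ _ => zero_le) x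
    have hb2 : ∀ x, b x ^ 2 = b x := fun x => by by_cases hx : x ∈ B <;> simp [b, hx]
    -- At each point only the slice containing it contributes; the series form makes measurability
    -- evident.
    let p : X → ℝ≥0∞ := fun x => ∑' n, (Y n).indicator (fun x => b x * (S n x)⁻¹) x
    have hp : Measurable p := Measurable.tsum fun n =>
      ((hb.mul (hS n).inv).mono hA le_rfl).indicator (hY n)
    have hpe : ∀ x, p x = b x * (S ⌊‖u x‖⌋₊ x)⁻¹ := by
      intro x
      simp only [p]
      rw [tsum_eq_single ⌊‖u x‖⌋₊]
      · simp [Y]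
      · intro n hn
        have : x ∉ Y n := fun h => hn h.symm
        simp [this]
    have hptop : ∀ x, p x ≠ ∞ := fun x => by
      rw [hpe]
      refine ENNReal.mul_ne_top ((hb1 x).trans_lt ENNReal.one_lt_top).ne
        (ENNReal.inv_ne_top.2 ?_)
      simp [S]
    let f : X → ℂ := fun x => ((p x * ‖u x‖ₑ).toReal : ℂ)
    have hf : Measurable f := Complex.measurable_ofReal.comp (hp.mul hu.enorm).ennreal_toReal
    have hfe : ∀ x, ‖f x‖ₑ = p x * ‖u x‖ₑ := fun x => by
      have : p x * ‖u x‖ₑ ≠ ∞ := ENNReal.mul_ne_top (hptop x) enorm_ne_top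
      rw [← ofReal_norm]
      simp only [f, Complex.norm_real, Real.norm_eq_abs, abs_of_nonneg ENNReal.toReal_nonneg,
        ENNReal.ofReal_toReal this]
    have hfL : MemLp f 2 μ := by
      refine (memLp_two_iff_lintegral hf.aemeasurable).2 ?_
      have e1 : ∀ x, ‖f x‖ₑ ^ 2 = ∑' n, (b x * ((S n x) ^ 2)⁻¹) * G n x := by
        intro x
        rw [hGsum, hfe, hpe, mul_pow, mul_pow, hb2, ENNReal.inv_pow]
      have hc : ∀ n, Measurable[A] fun x => b x * ((S n x) ^ 2)⁻¹ := fun n =>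
        hb.mul ((hS n).pow_const 2).inv
      have hc' : ∀ n, AEMeasurable (fun x => b x * ((S n x) ^ 2)⁻¹) μ := fun n =>
        ((hc n).mono hA le_rfl).aemeasurable
      simp only [e1]
      rw [lintegral_tsum (f := fun n x => (b x * ((S n x) ^ 2)⁻¹) * G n x)
        fun n => (hc' n).mul (hG n)]
      have e2 : ∀ n, ∫⁻ x, (b x * ((S n x) ^ 2)⁻¹) * G n x ∂μ =
          ∫⁻ x, (b x * ((S n x) ^ 2)⁻¹) * D n x ∂μ := fun n =>
        (lintegral_mul_condLExp hA (hc n) (hG n)).symm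
      simp only [e2]
      rw [← lintegral_tsum (f := fun n x => (b x * ((S n x) ^ 2)⁻¹) * D n x)
        fun n => (hc' n).mul ((hD n).mono hA le_rfl).aemeasurable]
      have hle : ∀ᵐ x ∂μ, ∑' n, (b x * ((S n x) ^ 2)⁻¹) * D n x ≤ b x := by
        filter_upwards [hDtop] with x hx
        have e3 : ∀ n, (b x * ((S n x) ^ 2)⁻¹) * D n x = b x * (D n x / (S n x) ^ 2) :=
          fun n => by rw [div_eq_mul_inv]; ring
        simp only [e3]
        rw [ENNReal.tsum_mul_left]
        exact mul_le_of_le_one_right zero_le (tsum_div_sq_le_one (fun n => D n x) hx)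
      refine (lintegral_mono_ae hle).trans_lt ?_
      rw [lintegral_indicator (hA _ hBm)]
      simpa using hBfin
    have e1 : ∀ x, ‖u x * f x‖ₑ = ∑' n, (b x * (S n x)⁻¹) * G n x := by
      intro x
      rw [hGsum, enorm_mul, hfe, hpe]
      ring
    have hc : ∀ n, Measurable[A] fun x => b x * (S n x)⁻¹ := fun n => hb.mul (hS n).inv
    have h1 := (huf f hfL).2
    simp only [e1] at h1
    have h2 := condLExp_tsum_apply (A := A) (F := fun n x => (b x * (S n x)⁻¹) * G n x)
      fun n => ((hc n).mono hA le_rfl).aemeasurable.mul (hG n)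
    have h3 : ∀ᵐ x ∂μ, ∀ n, condLExp A μ (fun x => (b x * (S n x)⁻¹) * G n x) x =
        (b x * (S n x)⁻¹) * D n x :=
      ae_all_iff.2 fun n => condLExp_mul_left hA (hc n) (hG n)
    filter_upwards [h1, h2, h3, hDtop] with x h1 h2 h3 h4 hxB
    rw [h2] at h1
    simp only [h3] at h1
    have hbx : b x = 1 := by simp [b, hxB]
    refine tsum_lt_top_of_tsum_div_lt_top (fun n => D n x) h4 ?_
    simpa [hbx, div_eq_mul_inv, mul_comm] using h1
  filter_upwards [hsum, ae_all_iff.2 main] with x hx1 hx2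
  rw [hx1]
  obtain ⟨i, hi⟩ := Set.mem_iUnion.1 ((iUnion_spanningSets (μ.trim hA)).symm ▸ Set.mem_univ x)
  exact hx2 i hi

theorem condSq_lt_top_of_conditionable_mul (hA : A ≤ mX) [SigmaFinite (μ.trim hA)]
    (u : X →ₘ[μ] ℂ) (huf : ∀ f : Lp ℂ 2 μ, Conditionable A μ (fun x => u x * f x)) :
    ∀ᵐ x ∂μ, condSq A μ u x < ∞ :=
  condSq_lt_top_of_conditionable_mul_of_measurable hA u.measurable fun f hf =>
    (huf (hf.toLp f)).congr (hf.coeFn_toLp.mono fun x hx => by simp only [hx])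

end Conditionable

/-! ### Orthogonal projection onto the graph of an abstract operator. -/

section Graph

variable {H : Type*} [NormedAddCommGroup H] [InnerProductSpace ℂ H] (T : H →ₗ.[ℂ] H)

theorem mem_graphSum {x y : H} :
    WithLp.toLp 2 (x, y) ∈ graphSum T ↔ (x, y) ∈ T.graph := Iff.rfl

variable {T}

/-- The hypothesis says `s = T*r`, phrased without forming the adjoint. -/
theorem mem_graphSum_orthogonal {s r : H}
    (h : ∀ p : T.domain, inner ℂ s (p : H) = inner ℂ r (T p)) :
    WithLp.toLp 2 (s, -r) ∈ (graphSum T)ᗮ := by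
  refine (Submodule.mem_orthogonal' _ _).2 fun v hv => ?_
  obtain ⟨p, hp⟩ := (LinearPMap.mem_graph_iff T).1 (show WithLp.ofLp v ∈ T.graph from hv)
  rw [WithLp.prod_inner_apply]
  simp only [inner_neg_left]
  rw [← hp.1, ← hp.2, h p, add_neg_cancel]

theorem hasOrthogonalProjection_graphSum
    (h₁ : ∀ f : H, ∃ s r : H, (∀ p : T.domain, inner ℂ s (p : H) = inner ℂ r (T p)) ∧
      (f - s, r) ∈ T.graph)
    (h₂ : ∀ g : H, ∃ s r : H, (∀ p : T.domain, inner ℂ s (p : H) = inner ℂ r (T p)) ∧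
      (s, g - r) ∈ T.graph) : (graphSum T).HasOrthogonalProjection := by
  refine ⟨fun v => ?_⟩
  obtain ⟨s, r, ho, hg⟩ := h₁ v.fst
  obtain ⟨s', r', ho', hg'⟩ := h₂ v.snd
  refine ⟨WithLp.toLp 2 (v.fst - s, r) + WithLp.toLp 2 (s', v.snd - r'),
    add_mem ((mem_graphSum T).2 hg) ((mem_graphSum T).2 hg'), ?_⟩
  have e : v - (WithLp.toLp 2 (v.fst - s, r) + WithLp.toLp 2 (s', v.snd - r')) =
      WithLp.toLp 2 (s, -r) - WithLp.toLp 2 (s', -r') := by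
    apply WithLp.ofLp_injective
    ext
    · simp; abel
    · simp; abel
  rw [e]
  exact sub_mem (mem_graphSum_orthogonal ho) (mem_graphSum_orthogonal ho')

variable [(graphSum T).HasOrthogonalProjection]

theorem charMatrix_apply_left {f s r : H}
    (h : ∀ p : T.domain, inner ℂ s (p : H) = inner ℂ r (T p)) (hg : (f - s, r) ∈ T.graph) :
    charMatrix T 0 0 f = f - s ∧ charMatrix T 1 0 f = r := by
  have e : (graphSum T).starProjection (WithLp.toLp 2 (f, 0)) = WithLp.toLp 2 (f - s, r) := by
    refine Submodule.eq_starProjection_of_mem_orthogonal' ((mem_graphSum T).2 hg)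
      (mem_graphSum_orthogonal h) ?_
    rw [← WithLp.toLp_add]
    simp
  constructor
  · simp [charMatrix, e]
  · simp [charMatrix, e]

theorem charMatrix_apply_right {g s r : H}
    (h : ∀ p : T.domain, inner ℂ s (p : H) = inner ℂ r (T p)) (hg : (s, g - r) ∈ T.graph) :
    charMatrix T 0 1 g = s ∧ charMatrix T 1 1 g = g - r := by
  have e : (graphSum T).starProjection (WithLp.toLp 2 (0, g)) = WithLp.toLp 2 (s, g - r) := by
    refine Submodule.eq_starProjection_of_mem_orthogonal' ((mem_graphSum T).2 hg)
      (neg_mem (mem_graphSum_orthogonal h)) ?_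
    rw [← WithLp.toLp_neg, ← WithLp.toLp_add]
    simp
  constructor
  · simp [charMatrix, e]
  · simp [charMatrix, e]

end Graph

/-! ### The weighted conditional type operator: adjoint relation, degenerate set, explicit columns.
-/

section Core

variable {X : Type*} {A mX : MeasurableSpace X} {μ : Measure X}

theorem coeFn_wct (w u : X →ₘ[μ] ℂ) (p : (wct A μ w u).domain) :
    (wct A μ w u p : X → ℂ) =ᵐ[μ]
      fun x => w x * condExpC A μ (fun y => u y * (p : Lp ℂ 2 μ) y) x :=
  MemLp.coeFn_toLp p.2.2

theorem mem_graph_wct {w u : X →ₘ[μ] ℂ} {f g : Lp ℂ 2 μ}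
    (hf : Conditionable A μ (fun x => u x * f x))
    (hg : g =ᵐ[μ] fun x => w x * condExpC A μ (fun y => u y * f y) x) :
    (f, g) ∈ (wct A μ w u).graph := by
  have hm : f ∈ (wct A μ w u).domain := ⟨hf, (memLp_congr_ae hg).1 (Lp.memLp g)⟩
  refine (LinearPMap.mem_graph_iff _).2 ⟨⟨f, hm⟩, rfl, Lp.ext ?_⟩
  exact (coeFn_wct w u ⟨f, hm⟩).trans hg.symm

theorem integrable_inner_mul (f g : Lp ℂ 2 μ) : Integrable (fun x => g x * star (f x)) μ :=
  L2.integrable_inner (𝕜 := ℂ) f g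

theorem inner_eq_integral (f g : Lp ℂ 2 μ) : inner ℂ f g = ∫ x, g x * star (f x) ∂μ := rfl

/-- Both inner products are integrals of integrable functions, so `E` may be inserted under each
integral. Pulling out the `A`-measurable factor gives `star E(w̄r) · E(up)` in both cases. -/
theorem inner_wct_eq (hA : A ≤ mX) [SigmaFinite (μ.trim hA)] {w u : X →ₘ[μ] ℂ} {s r : Lp ℂ 2 μ}
    (hr : Conditionable A μ (fun x => star (w x) * r x))
    (hs : s =ᵐ[μ] fun x => star (u x) * condExpC A μ (fun y => star (w y) * r y) x)
    (p : (wct A μ w u).domain) :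
    inner ℂ s (p : Lp ℂ 2 μ) = inner ℂ r (wct A μ w u p) := by
  set φ : Lp ℂ 2 μ := (p : Lp ℂ 2 μ)
  set c : X → ℂ := condExpC A μ (fun y => star (w y) * r y)
  set e : X → ℂ := condExpC A μ (fun y => u y * φ y)
  have hc : Measurable[A] fun x => star (c x) :=
    continuous_star.measurable.comp (measurable_condExpC _)
  have he : Measurable[A] e := measurable_condExpC _
  have hp : Conditionable A μ (fun x => u x * φ x) := p.2.1
  have e1 : (fun x => φ x * star (s x)) =ᵐ[μ] fun x => star (c x) * (u x * φ x) := by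
    filter_upwards [hs] with x hx
    rw [hx, star_mul', star_star]
    ring
  have e2 : (fun x => wct A μ w u p x * star (r x)) =ᵐ[μ]
      fun x => e x * star (star (w x) * r x) := by
    filter_upwards [coeFn_wct w u p] with x hx
    rw [hx, star_mul', star_star]
    ring
  have i1 := (integrable_inner_mul s φ).congr e1
  have i2 := (integrable_inner_mul r (wct A μ w u p)).congr e2
  rw [inner_eq_integral, inner_eq_integral, integral_congr_ae e1, integral_congr_ae e2,
    ← integral_condExpC hA i1, ← integral_condExpC hA i2]
  refine integral_congr_ae ?_
  filter_upwards [condExpC_mul_left hA hc hp, condExpC_mul_left hA he hr.star] with x h1 h2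
  rw [h1, h2, condExpC_star, mul_comm]

/-- The integral of `|E(uf)|² E(|w|²)` equals `‖Tf‖²`, so the integrand is finite almost everywhere.
-/
theorem condExpC_mul_eq_zero_of_condSq_eq_top (hA : A ≤ mX) [SigmaFinite (μ.trim hA)]
    {w u : X →ₘ[μ] ℂ} {f : Lp ℂ 2 μ} (hf : f ∈ (wct A μ w u).domain) :
    ∀ᵐ x ∂μ, condSq A μ w x = ∞ → condExpC A μ (fun y => u y * f y) x = 0 := by
  have hm : MemLp (fun x => w x * condExpC A μ (fun y => u y * f y) x) 2 μ := hf.2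
  have h1 := (memLp_two_iff_lintegral hm.1.aemeasurable).1 hm
  simp only [mul_comm (w _)] at h1
  have hc := measurable_condExpC (A := A) (μ := μ) fun y => u y * f y
  rw [lintegral_enorm_sq_mul hA hc w.measurable.aemeasurable] at h1
  have hm' : Measurable fun x => ‖condExpC A μ (fun y => u y * f y) x‖ₑ ^ 2 * condSq A μ w x :=
    (((measurable_enorm.comp hc).pow_const 2).mul (measurable_condSq _)).mono hA le_rfl
  filter_upwards [ae_lt_top hm' h1.ne] with x hx hx'
  by_contra h0
  rw [hx', ENNReal.mul_top (by simpa using h0)] at hx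
  exact lt_irrefl _ hx

/-- For `B` in `A` inside the set where `E(|w|²) = ∞`, the function `1_B ū` is orthogonal to the
domain, since `⟨1_B ū, f⟩ = ∫_B E(uf) = 0`. By density it vanishes, and its squared norm is `∫_B
E(|u|²)`. -/
theorem condSq_eq_zero_of_dense (hA : A ≤ mX) [SigmaFinite (μ.trim hA)] {w u : X →ₘ[μ] ℂ}
    (hu : ∀ᵐ x ∂μ, condSq A μ u x < ∞)
    (hT : Dense ((wct A μ w u).domain : Set (Lp ℂ 2 μ))) :
    ∀ᵐ x ∂μ, condSq A μ w x = ∞ → condSq A μ u x = 0 := by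
  have hu' : AEMeasurable (fun x => star (u x)) μ :=
    (continuous_star.measurable.comp u.measurable).aemeasurable
  have main : ∀ i N : ℕ, ∀ᵐ x ∂μ, x ∈ spanningSets (μ.trim hA) i → condSq A μ u x ≤ N →
      condSq A μ w x = ∞ → condSq A μ u x = 0 := by
    intro i N
    -- Finite measure and the bound `N` serve to put `1_B ū` in `L²`; countably many such sets
    -- exhaust the degenerate set.
    set B : Set X := spanningSets (μ.trim hA) i ∩
      ({x | condSq A μ u x ≤ N} ∩ {x | condSq A μ w x = ∞}) with hB
    have hB1 : MeasurableSet[A] (spanningSets (μ.trim hA) i) :=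
      measurableSet_spanningSets (μ.trim hA) i
    have hB2 : MeasurableSet[A] {x | condSq A μ u x ≤ N} :=
      measurable_condSq (A := A) (μ := μ) u measurableSet_Iic
    have hB3 : MeasurableSet[A] {x | condSq A μ w x = ∞} :=
      measurable_condSq (A := A) (μ := μ) w (measurableSet_singleton ∞)
    have hBm : MeasurableSet[A] B := hB1.inter (hB2.inter hB3)
    have hBfin : μ B < ∞ := by
      refine (measure_mono Set.inter_subset_left).trans_lt ?_
      rw [← trim_measurableSet_eq hA hB1]
      exact measure_spanningSets_lt_top (μ.trim hA) i
    let b : X → ℂ := B.indicator fun _ => 1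
    have hb : Measurable[A] b := measurable_const.indicator hBm
    have hint : ∫⁻ x, ‖b x * star (u x)‖ₑ ^ 2 ∂μ = ∫⁻ x in B, condSq A μ u x ∂μ := by
      rw [lintegral_enorm_sq_mul hA hb hu', condSq_star, ← lintegral_indicator (hA _ hBm)]
      refine lintegral_congr fun x => ?_
      by_cases hx : x ∈ B <;> simp [b, hx]
    have hL : MemLp (fun x => b x * star (u x)) 2 μ := by
      refine (memLp_two_iff_lintegral ((hb.mono hA le_rfl).aemeasurable.mul hu')).2 ?_
      refine hint.trans_lt ?_
      calc _ ≤ ∫⁻ _ in B, (N : ℝ≥0∞) ∂μ :=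
            setLIntegral_mono measurable_const fun x hx => hx.2.1
        _ < ∞ := by
            rw [setLIntegral_const]
            exact ENNReal.mul_lt_top (by simp) hBfin
    have horth : ∀ f ∈ ((wct A μ w u).domain : Set (Lp ℂ 2 μ)),
        inner ℂ (hL.toLp _) f = 0 := by
      intro f hf
      have e1 : (fun x => f x * star (hL.toLp _ x)) =ᵐ[μ] fun x => b x * (u x * f x) := by
        filter_upwards [hL.coeFn_toLp] with x hx
        have : star (b x) = b x := by by_cases h : x ∈ B <;> simp [b, h]
        rw [hx, star_mul', star_star, this]
        ring
      rw [inner_eq_integral, integral_congr_ae e1,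
        ← integral_condExpC hA ((integrable_inner_mul _ f).congr e1)]
      refine integral_eq_zero_of_ae ?_
      filter_upwards [condExpC_mul_left hA hb hf.1,
        condExpC_mul_eq_zero_of_condSq_eq_top hA hf] with x h1 h2
      rw [h1]
      by_cases h : x ∈ B
      · rw [h2 h.2.2, mul_zero, Pi.zero_apply]
      · simp [b, h]
    have h0 := hT.eq_zero_of_inner_left ℂ horth
    have h1 : (fun x => b x * star (u x)) =ᵐ[μ] 0 := by
      have h2 := hL.coeFn_toLp
      rw [h0] at h2
      exact h2.symm.trans (Lp.coeFn_zero ℂ 2 μ)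
    have h2 : ∫⁻ x in B, condSq A μ u x ∂μ = 0 := by
      rw [← hint]
      refine (lintegral_congr_ae (h1.mono fun x hx => ?_)).trans lintegral_zero
      simp only [Pi.zero_apply] at hx
      rw [hx]
      simp
    rw [setLIntegral_eq_zero_iff (hA _ hBm) ((measurable_condSq _).mono hA le_rfl)] at h2
    filter_upwards [h2] with x hx h3 h4 h5 using hx ⟨h3, h4, h5⟩
  filter_upwards [ae_all_iff.2 fun i => ae_all_iff.2 (main i), hu] with x hx hux hwx
  obtain ⟨i, hi⟩ := Set.mem_iUnion.1 ((iUnion_spanningSets (μ.trim hA)).symm ▸ Set.mem_univ x)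
  obtain ⟨N, hN⟩ := ENNReal.exists_nat_gt hux.ne
  exact hx i N hi hN.le hwx

theorem measurable_wctH (w u : X →ₘ[μ] ℂ) : Measurable[A] (wctH A μ w u) :=
  measurable_const.div (measurable_const.add
    ((measurable_condSq (A := A) (μ := μ) u).ennreal_toReal.mul
      (measurable_condSq (A := A) (μ := μ) w).ennreal_toReal))

theorem measurable_wctH1 (w u : X →ₘ[μ] ℂ) : Measurable[A] (wctH1 A μ w u) :=
  (measurable_condSq (A := A) (μ := μ) w).ennreal_toReal.mul (measurable_wctH w u)

theorem measurable_wctH2 (w u : X →ₘ[μ] ℂ) : Measurable[A] (wctH2 A μ w u) :=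
  (measurable_condSq (A := A) (μ := μ) u).ennreal_toReal.mul (measurable_wctH w u)

theorem wctH_mul (w u : X →ₘ[μ] ℂ) (x : X) :
    wctH A μ w u x * (1 + (condSq A μ u x).toReal * (condSq A μ w x).toReal) = 1 :=
  one_div_mul_cancel (by positivity)

theorem wctH_pos (w u : X →ₘ[μ] ℂ) (x : X) : 0 < wctH A μ w u x := by
  unfold wctH
  positivity

theorem wctH_le_one (w u : X →ₘ[μ] ℂ) (x : X) : wctH A μ w u x ≤ 1 :=
  (div_le_one (by positivity)).2 (le_add_of_nonneg_right (by positivity))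

theorem wctH_sq_mul_le_one (w u : X →ₘ[μ] ℂ) (x : X) :
    wctH A μ w u x ^ 2 * ((condSq A μ u x).toReal * (condSq A μ w x).toReal) ≤ 1 := by
  have h1 := wctH_mul (A := A) w u x
  have h2 := wctH_pos (A := A) w u x
  have h3 := wctH_le_one (A := A) w u x
  generalize (condSq A μ u x).toReal * (condSq A μ w x).toReal = t at *
  have e : wctH A μ w u x ^ 2 * t = wctH A μ w u x * (1 - wctH A μ w u x) := by
    linear_combination wctH A μ w u x * h1
  rw [e]
  exact mul_le_one₀ h3 (sub_nonneg.2 h3) (sub_le_self _ h2.le)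

theorem mul_wctH_sq_le_one (w u : X →ₘ[μ] ℂ) (x : X) :
    ((condSq A μ u x).toReal * (condSq A μ w x).toReal * wctH A μ w u x) ^ 2 ≤ 1 := by
  have h1 := wctH_mul (A := A) w u x
  have h2 := wctH_pos (A := A) w u x
  have h3 := wctH_le_one (A := A) w u x
  have e : (condSq A μ u x).toReal * (condSq A μ w x).toReal * wctH A μ w u x =
      1 - wctH A μ w u x := by linear_combination h1
  rw [e]
  exact pow_le_one₀ (sub_nonneg.2 h3) (sub_le_self _ h2.le)

theorem enorm_sq_mul_le_one {b : ℝ} {p q : ℝ≥0∞} (hp : p ≠ ∞) (hq : q ≠ ∞)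
    (h : b ^ 2 * (p.toReal * q.toReal) ≤ 1) : ‖b‖ₑ ^ 2 * (p * q) ≤ 1 := by
  have e : ‖b‖ₑ ^ 2 * (p * q) = ENNReal.ofReal (b ^ 2 * (p.toReal * q.toReal)) := by
    rw [ENNReal.ofReal_mul (sq_nonneg b), ENNReal.ofReal_mul ENNReal.toReal_nonneg,
      ENNReal.ofReal_toReal hp, ENNReal.ofReal_toReal hq, ← sq_abs,
      ENNReal.ofReal_pow (abs_nonneg b), ← Real.norm_eq_abs, ofReal_norm]
  rw [e]
  exact ENNReal.ofReal_le_one.2 h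

/-- This makes `E(|v|²)` act as a scalar. A separate `z` lets it serve both for `v = u`, `z = ū` and
for `v = w̄`, `z = w`. -/
theorem condExpC_mul_coeff_mul (hA : A ≤ mX) [SigmaFinite (μ.trim hA)] {v z : X → ℂ}
    (hv : AEMeasurable v μ) (hv' : ∀ᵐ x ∂μ, condSq A μ v x < ∞)
    (hz : ∀ x, z x = star (v x)) {b : X → ℝ} (hb : Measurable[A] b) {c : X → ℂ}
    (hc : Measurable[A] c) :
    condExpC A μ (fun y => v y * (b y * c y * z y)) =ᵐ[μ]
      fun x => (condSq A μ v x).toReal * (b x * c x) := by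
  have e : (fun y => v y * (b y * c y * z y)) = fun y => (b y * c y) * (star (v y) * v y) := by
    funext y
    rw [hz]
    ring
  have hcond : Conditionable A μ (fun y => star (v y) * v y) := by
    refine ⟨(continuous_star.measurable.comp_aemeasurable hv).mul hv, ?_⟩
    simpa [condSq, enorm_mul, sq] using hv'
  have hbc : Measurable[A] fun x => (b x : ℂ) * c x :=
    (Complex.measurable_ofReal.comp hb).mul hc
  rw [e]
  filter_upwards [condExpC_mul_left hA hbc hcond] with x hx
  rw [hx, condExpC_star_mul_self]
  ring

variable (w u : X →ₘ[μ] ℂ)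

/-- With `c = E(uf)`, the ansatz `r = h w c` gives `T*r = ū E(|w|²) h c = h₁ ū c = s`, and `T(f - s)
= w (1 - E(|u|²) h₁) c = h w c = r`. -/
theorem exists_left_column (hA : A ≤ mX) [SigmaFinite (μ.trim hA)]
    (hu : ∀ᵐ x ∂μ, condSq A μ u x < ∞) (hw : ∀ᵐ x ∂μ, condSq A μ w x < ∞) (f : Lp ℂ 2 μ) :
    ∃ s r : Lp ℂ 2 μ,
      ((∀ p : (wct A μ w u).domain, inner ℂ s (p : Lp ℂ 2 μ) = inner ℂ r (wct A μ w u p)) ∧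
        (f - s, r) ∈ (wct A μ w u).graph) ∧
      (s =ᵐ[μ] fun x => wctH1 A μ w u x * star (u x) * condExpC A μ (fun y => u y * f y) x) ∧
      (r =ᵐ[μ] fun x => wctH A μ w u x * w x * condExpC A μ (fun y => u y * f y) x) := by
  have hum := u.measurable.aemeasurable (μ := μ)
  have hwm := w.measurable.aemeasurable (μ := μ)
  have hus := continuous_star.measurable.comp_aemeasurable hum
  have hws := continuous_star.measurable.comp_aemeasurable hwm
  have hws' : ∀ᵐ x ∂μ, condSq A μ (fun y => star (w y)) x < ∞ := by rwa [condSq_star]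
  set c : X → ℂ := condExpC A μ (fun y => u y * f y)
  have hc : Measurable[A] c := measurable_condExpC _
  have mr : MemLp (fun x => wctH A μ w u x * c x * w x) 2 μ := by
    refine memLp_mul_condExpC_mul hA (measurable_wctH w u) hum hwm hu (Lp.memLp f) ?_
    filter_upwards [hu, hw] with x h1 h2
    exact enorm_sq_mul_le_one h1.ne h2.ne (wctH_sq_mul_le_one w u x)
  -- Both factors contribute `E(|u|²)`, so the bound needed is `(E(|u|²) h₁)² ≤ 1`; it holds as
  -- `E(|u|²) h₁ = 1 - h`.
  have ms : MemLp (fun x => wctH1 A μ w u x * c x * star (u x)) 2 μ := by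
    refine memLp_mul_condExpC_mul hA (measurable_wctH1 w u) hum hus hu (Lp.memLp f) ?_
    change ∀ᵐ x ∂μ, _ * (_ * condSq A μ (fun y => star (u y)) x) ≤ 1
    rw [condSq_star]
    filter_upwards [hu] with x h1
    refine enorm_sq_mul_le_one h1.ne h1.ne (le_of_eq_of_le ?_ (mul_wctH_sq_le_one (A := A) w u x))
    rw [wctH1]
    ring
  refine ⟨ms.toLp _, mr.toLp _, ⟨?_, ?_⟩, ?_, ?_⟩
  · refine inner_wct_eq hA (conditionable_mul hws hws' (Lp.memLp _)) ?_
    have h1 : (fun y => star (w y) * (mr.toLp _ : Lp ℂ 2 μ) y) =ᵐ[μ]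
        fun y => star (w y) * (wctH A μ w u y * c y * w y) :=
      mr.coeFn_toLp.mono fun x hx => by simp only [hx]
    filter_upwards [ms.coeFn_toLp, condExpC_congr (A := A) h1,
      condExpC_mul_coeff_mul hA hws hws' (fun x => (star_star (w x)).symm) (measurable_wctH w u) hc]
      with x h1 h2 h3
    simp only [Function.comp_apply] at h3
    rw [h1, h2, h3]
    change _ = _ * (((condSq A μ (fun y => star (w y)) x).toReal : ℂ) * _)
    rw [condSq_star, wctH1]
    push_cast
    ring
  · refine mem_graph_wct (conditionable_mul hum hu (Lp.memLp _)) ?_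
    have h1 : (fun y => u y * f y + (-1) * (u y * (wctH1 A μ w u y * c y * star (u y)))) =ᵐ[μ]
        (fun y => u y * (f - ms.toLp _ : Lp ℂ 2 μ) y) := by
      filter_upwards [Lp.coeFn_sub f (ms.toLp _), ms.coeFn_toLp] with x h1 h2
      rw [h1, Pi.sub_apply, h2]
      ring
    have k1 := conditionable_mul hum hu (Lp.memLp f)
    have k2 := conditionable_mul hum hu ms
    filter_upwards [mr.coeFn_toLp, condExpC_congr (A := A) h1,
      condExpC_add k1 (k2.const_mul (-1)), condExpC_const_mul (-1) k2,
      condExpC_mul_coeff_mul hA hum hu (fun x => rfl) (measurable_wctH1 w u) hc]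
      with x h1 h2 h3 h4 h5
    rw [h1, ← h2, h3, h4, h5, wctH1]
    have h6 := congrArg (fun t : ℝ => (t : ℂ)) (wctH_mul (A := A) w u x)
    push_cast at h6 ⊢
    linear_combination (w x * c x) * h6
  · filter_upwards [ms.coeFn_toLp] with x hx
    rw [hx]
    ring
  · filter_upwards [mr.coeFn_toLp] with x hx
    rw [hx]
    ring

/-- With `c = E(w̄g)`, put `s = h ū c`. Then `Ts = E(|u|²) h w c = h₂ w c`, which is to be `g - r`,
and `T*r = ū (1 - E(|w|²) h₂) c = h ū c = s`. -/
theorem exists_right_column (hA : A ≤ mX) [SigmaFinite (μ.trim hA)]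
    (hu : ∀ᵐ x ∂μ, condSq A μ u x < ∞) (hw : ∀ᵐ x ∂μ, condSq A μ w x < ∞) (g : Lp ℂ 2 μ) :
    ∃ s r : Lp ℂ 2 μ,
      ((∀ p : (wct A μ w u).domain, inner ℂ s (p : Lp ℂ 2 μ) = inner ℂ r (wct A μ w u p)) ∧
        (s, g - r) ∈ (wct A μ w u).graph) ∧
      (s =ᵐ[μ] fun x =>
        wctH A μ w u x * star (u x) * condExpC A μ (fun y => star (w y) * g y) x) ∧
      ((g - r : Lp ℂ 2 μ) =ᵐ[μ] fun x =>
        wctH2 A μ w u x * w x * condExpC A μ (fun y => star (w y) * g y) x) := by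
  have hum := u.measurable.aemeasurable (μ := μ)
  have hwm := w.measurable.aemeasurable (μ := μ)
  have hus := continuous_star.measurable.comp_aemeasurable hum
  have hws := continuous_star.measurable.comp_aemeasurable hwm
  have hws' : ∀ᵐ x ∂μ, condSq A μ (fun y => star (w y)) x < ∞ := by rwa [condSq_star]
  set c : X → ℂ := condExpC A μ (fun y => star (w y) * g y)
  have hc : Measurable[A] c := measurable_condExpC _
  have ms : MemLp (fun x => wctH A μ w u x * c x * star (u x)) 2 μ := by
    refine memLp_mul_condExpC_mul hA (measurable_wctH w u) hws hus hws' (Lp.memLp g) ?_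
    change ∀ᵐ x ∂μ, _ * (condSq A μ (fun y => star (w y)) x *
      condSq A μ (fun y => star (u y)) x) ≤ 1
    rw [condSq_star, condSq_star]
    filter_upwards [hu, hw] with x h1 h2
    refine enorm_sq_mul_le_one h2.ne h1.ne ?_
    rw [mul_comm (condSq A μ w x).toReal]
    exact wctH_sq_mul_le_one w u x
  have mr : MemLp (fun x => wctH2 A μ w u x * c x * w x) 2 μ := by
    refine memLp_mul_condExpC_mul hA (measurable_wctH2 w u) hws hwm hws' (Lp.memLp g) ?_
    rw [condSq_star]
    filter_upwards [hw] with x h1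
    refine enorm_sq_mul_le_one h1.ne h1.ne (le_of_eq_of_le ?_ (mul_wctH_sq_le_one (A := A) w u x))
    rw [wctH2]
    ring
  refine ⟨ms.toLp _, g - mr.toLp _, ⟨?_, ?_⟩, ?_, ?_⟩
  · refine inner_wct_eq hA (conditionable_mul hws hws' (Lp.memLp _)) ?_
    have h1 : (fun y => star (w y) * g y + (-1) * (star (w y) * (wctH2 A μ w u y * c y * w y)))
        =ᵐ[μ] (fun y => star (w y) * (g - mr.toLp _ : Lp ℂ 2 μ) y) := by
      filter_upwards [Lp.coeFn_sub g (mr.toLp _), mr.coeFn_toLp] with x h1 h2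
      rw [h1, Pi.sub_apply, h2]
      ring
    have k1 := conditionable_mul hws hws' (Lp.memLp g)
    have k2 := conditionable_mul hws hws' mr
    filter_upwards [ms.coeFn_toLp, condExpC_congr (A := A) h1,
      condExpC_add k1 (k2.const_mul (-1)), condExpC_const_mul (-1) k2,
      condExpC_mul_coeff_mul hA hws hws' (fun x => (star_star (w x)).symm)
        (measurable_wctH2 w u) hc] with x h1 h2 h3 h4 h5
    simp only [Function.comp_apply] at h3 h4 h5
    rw [h1, ← h2, h3, h4, h5]
    change _ = _ * (_ + _ * (((condSq A μ (fun y => star (w y)) x).toReal : ℂ) * _))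
    rw [condSq_star, wctH2]
    -- This is `1 - E(|w|²) h₂ = h`, with denominators cleared.
    have h6 := congrArg (fun t : ℝ => (t : ℂ)) (wctH_mul (A := A) w u x)
    push_cast at h6 ⊢
    linear_combination (star (u x) * c x) * h6
  · rw [sub_sub_cancel]
    refine mem_graph_wct (conditionable_mul hum hu (Lp.memLp _)) ?_
    have h1 : (fun y => u y * (ms.toLp _ : Lp ℂ 2 μ) y) =ᵐ[μ]
        fun y => u y * (wctH A μ w u y * c y * star (u y)) :=
      ms.coeFn_toLp.mono fun x hx => by simp only [hx]
    filter_upwards [mr.coeFn_toLp, condExpC_congr (A := A) h1,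
      condExpC_mul_coeff_mul hA hum hu (fun x => rfl) (measurable_wctH w u) hc]
      with x h1 h2 h3
    rw [h1, h2, h3, wctH2]
    push_cast
    ring
  · filter_upwards [ms.coeFn_toLp] with x hx
    rw [hx]
    ring
  · rw [sub_sub_cancel]
    filter_upwards [mr.coeFn_toLp] with x hx
    rw [hx]
    ring

end Core

/-! ### Reduction to finite `E(|w|²)`. -/

section Truncation

variable {X : Type*} {A mX : MeasurableSpace X} {μ : Measure X}

theorem ae_eq_zero_of_condSq_eq_zero (hA : A ≤ mX) [SigmaFinite (μ.trim hA)] {s : Set X}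
    (hs : MeasurableSet[A] s) (u : X →ₘ[μ] ℂ) (h : ∀ᵐ x ∂μ, x ∈ s → condSq A μ u x = 0) :
    ∀ᵐ x ∂μ, x ∈ s → u x = 0 := by
  have h1 : ∫⁻ x in s, ‖u x‖ₑ ^ 2 ∂μ = 0 := by
    rw [← setLIntegral_condLExp hA μ _ hs]
    exact (setLIntegral_eq_zero_iff (hA s hs) (measurable_condLExp' A μ _)).2 h
  rw [setLIntegral_eq_zero_iff (hA s hs) (u.measurable.enorm.pow_const 2)] at h1
  filter_upwards [h1] with x hx hxs
  simpa using hx hxs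

/-- The truncation of `w` to the set where `E(|w|²) < ∞`. -/
noncomputable def truncSq (A : MeasurableSpace X) {mX : MeasurableSpace X} {μ : Measure X}
    (hA : A ≤ mX) (w : X →ₘ[μ] ℂ) : X →ₘ[μ] ℂ :=
  AEEqFun.mk ({x | condSq A μ w x < ∞}.indicator w)
    (w.aestronglyMeasurable.indicator (hA _ (measurable_condSq w measurableSet_Iio)))

theorem measurableSet_condSq_lt_top (w : X → ℂ) :
    MeasurableSet[A] {x | condSq A μ w x < ∞} :=
  measurable_condSq w measurableSet_Iio

theorem coeFn_truncSq (hA : A ≤ mX) (w : X →ₘ[μ] ℂ) :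
    truncSq A hA w =ᵐ[μ] {x | condSq A μ w x < ∞}.indicator w :=
  AEEqFun.coeFn_mk _ _

theorem condSq_truncSq (hA : A ≤ mX) [SigmaFinite (μ.trim hA)] (w : X →ₘ[μ] ℂ) :
    condSq A μ (truncSq A hA w) =ᵐ[μ]
      {x | condSq A μ w x < ∞}.indicator (condSq A μ w) := by
  have hs := measurableSet_condSq_lt_top (A := A) (μ := μ) w
  have hwm : AEMeasurable (fun x => ‖w x‖ₑ ^ 2) μ := (w.measurable.enorm.pow_const 2).aemeasurable
  have htm : AEMeasurable (fun x => ‖truncSq A hA w x‖ₑ ^ 2) μ :=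
    ((truncSq A hA w).measurable.enorm.pow_const 2).aemeasurable
  have h1 := condLExp_congr_on hA hs htm hwm
    ((coeFn_truncSq hA w).mono fun x hx hxs => by rw [hx, Set.indicator_of_mem hxs])
  have h2 := condLExp_congr_on hA hs.compl htm (aemeasurable_const (b := 0))
    ((coeFn_truncSq hA w).mono fun x hx hxs => by simp [hx, Set.indicator_of_notMem hxs])
  have h3 : condLExp A μ (fun _ => 0) = 0 := condLExp_zero μ
  filter_upwards [h1, h2] with x h1 h2
  by_cases hx : x ∈ {x | condSq A μ w x < ∞}
  · rw [Set.indicator_of_mem hx]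
    exact h1 hx
  · rw [Set.indicator_of_notMem hx]
    exact (h2 hx).trans (by rw [h3]; rfl)

theorem condSq_truncSq_lt_top (hA : A ≤ mX) [SigmaFinite (μ.trim hA)] (w : X →ₘ[μ] ℂ) :
    ∀ᵐ x ∂μ, condSq A μ (truncSq A hA w) x < ∞ := by
  filter_upwards [condSq_truncSq hA w] with x hx
  rw [hx]
  by_cases h : x ∈ {x | condSq A μ w x < ∞}
  · rwa [Set.indicator_of_mem h]
  · rw [Set.indicator_of_notMem h]
    exact ENNReal.zero_lt_top

/-- Where `E(|w|²) = ∞` the truncation has conditional square `0`, and `∞` also has real value `0`.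
Hence `h`, `h₁` and `h₂` do not see the truncation. -/
theorem toReal_condSq_truncSq (hA : A ≤ mX) [SigmaFinite (μ.trim hA)] (w : X →ₘ[μ] ℂ) :
    ∀ᵐ x ∂μ, (condSq A μ (truncSq A hA w) x).toReal = (condSq A μ w x).toReal := by
  filter_upwards [condSq_truncSq hA w] with x hx
  rw [hx]
  by_cases h : x ∈ {x | condSq A μ w x < ∞}
  · rw [Set.indicator_of_mem h]
  · rw [Set.indicator_of_notMem h, not_lt_top_iff.1 (show ¬condSq A μ w x < ∞ from h)]
    simp

variable {w u : X →ₘ[μ] ℂ}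

theorem ae_eq_zero_of_condSq_not_lt_top (hA : A ≤ mX) [SigmaFinite (μ.trim hA)]
    (h0 : ∀ᵐ x ∂μ, condSq A μ w x = ∞ → condSq A μ u x = 0) :
    ∀ᵐ x ∂μ, ¬ condSq A μ w x < ∞ → u x = 0 :=
  ae_eq_zero_of_condSq_eq_zero hA (measurableSet_condSq_lt_top w).compl u
    (h0.mono fun _ hx h => hx (not_lt_top_iff.1 h))

theorem condExpC_mul_eq_zero_of_not_lt_top (hA : A ≤ mX) [SigmaFinite (μ.trim hA)]
    (h0 : ∀ᵐ x ∂μ, condSq A μ w x = ∞ → condSq A μ u x = 0) (f : Lp ℂ 2 μ) :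
    ∀ᵐ x ∂μ, ¬ condSq A μ w x < ∞ → condExpC A μ (fun y => u y * f y) x = 0 := by
  have h := condExpC_congr_on hA (measurableSet_condSq_lt_top (A := A) (μ := μ) w).compl
    (u.measurable.aemeasurable.mul (Lp.aestronglyMeasurable f).aemeasurable)
    (aemeasurable_const (b := 0)) ((ae_eq_zero_of_condSq_not_lt_top hA h0).mono
      fun x hx hxs => by simp [hx hxs])
  rw [condExpC_zero] at h
  exact h

theorem truncSq_mul_condExpC (hA : A ≤ mX) [SigmaFinite (μ.trim hA)]
    (h0 : ∀ᵐ x ∂μ, condSq A μ w x = ∞ → condSq A μ u x = 0) (f : Lp ℂ 2 μ) :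
    (fun x => truncSq A hA w x * condExpC A μ (fun y => u y * f y) x) =ᵐ[μ]
      fun x => w x * condExpC A μ (fun y => u y * f y) x := by
  filter_upwards [coeFn_truncSq hA w, condExpC_mul_eq_zero_of_not_lt_top hA h0 f] with x h1 h2
  by_cases h : x ∈ {x | condSq A μ w x < ∞}
  · rw [h1, Set.indicator_of_mem h]
  · rw [h2 h, mul_zero, mul_zero]

/-- Truncation alters `w` only where `E(uf) = 0`, so the domains agree as well as the values. -/
theorem wct_truncSq (hA : A ≤ mX) [SigmaFinite (μ.trim hA)]
    (h0 : ∀ᵐ x ∂μ, condSq A μ w x = ∞ → condSq A μ u x = 0) :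
    wct A μ (truncSq A hA w) u = wct A μ w u := by
  refine LinearPMap.ext ?_ fun f h1 h2 => ?_
  · ext f
    exact and_congr Iff.rfl (memLp_congr_ae (truncSq_mul_condExpC hA h0 f))
  · exact MemLp.toLp_congr h1.2 h2.2 (truncSq_mul_condExpC hA h0 f)

theorem condExpC_star_truncSq_mul (hA : A ≤ mX) [SigmaFinite (μ.trim hA)] (w : X →ₘ[μ] ℂ)
    (g : Lp ℂ 2 μ) :
    ∀ᵐ x ∂μ, condSq A μ w x < ∞ → condExpC A μ (fun y => star (truncSq A hA w y) * g y) x =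
      condExpC A μ (fun y => star (w y) * g y) x := by
  have m : ∀ v : X →ₘ[μ] ℂ, AEMeasurable (fun x => star (v x) * g x) μ := fun v =>
    (continuous_star.measurable.comp v.measurable).aemeasurable.mul
      (Lp.aestronglyMeasurable g).aemeasurable
  refine condExpC_congr_on hA (measurableSet_condSq_lt_top (A := A) (μ := μ) w) (m _) (m _) ?_
  filter_upwards [coeFn_truncSq hA w] with x hx hxs
  rw [hx, Set.indicator_of_mem (show x ∈ {x | condSq A μ w x < ∞} from hxs)]

end Truncation

theorem theorem2p14 {X : Type*} (A : MeasurableSpace X) [mX : MeasurableSpace X]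
    (μ : Measure X) [SigmaFinite μ] (hA : A ≤ mX) [SigmaFinite (μ.trim hA)]
    (w u : X →ₘ[μ] ℂ) (hw : Conditionable A μ w) (hu : Conditionable A μ u)
    (huf : ∀ f : Lp ℂ 2 μ, Conditionable A μ (fun x => u x * f x))
    (hT : Dense ((wct A μ w u).domain : Set (Lp ℂ 2 μ))) :
    (∀ᵐ x ∂μ, condSq A μ u x < ∞ ∧ condSq A μ u x * condSq A μ w x < ∞) ∧
    ∃ _ : (graphSum (wct A μ w u)).HasOrthogonalProjection,
      (∀ f : Lp ℂ 2 μ, charMatrix (wct A μ w u) 0 0 f =ᵐ[μ] fun x =>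
        f x - wctH1 A μ w u x * star (u x) * condExpC A μ (fun y => u y * f y) x) ∧
      (∀ f : Lp ℂ 2 μ, charMatrix (wct A μ w u) 1 0 f =ᵐ[μ] fun x =>
        wctH A μ w u x * w x * condExpC A μ (fun y => u y * f y) x) ∧
      (∀ f : Lp ℂ 2 μ, charMatrix (wct A μ w u) 0 1 f =ᵐ[μ] fun x =>
        wctH A μ w u x * star (u x) * condExpC A μ (fun y => star (w y) * f y) x) ∧
      (∀ f : Lp ℂ 2 μ, charMatrix (wct A μ w u) 1 1 f =ᵐ[μ] fun x =>
        wctH2 A μ w u x * w x * condExpC A μ (fun y => star (w y) * f y) x) := by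
  have hJ := condSq_lt_top_of_conditionable_mul hA u huf
  have h0 := condSq_eq_zero_of_dense hA hJ hT
  refine ⟨?_, ?_⟩
  · filter_upwards [hJ, h0] with x h1 h2
    refine ⟨h1, ?_⟩
    rcases eq_or_ne (condSq A μ w x) ∞ with h | h
    · rw [h2 h, zero_mul]
      exact ENNReal.zero_lt_top
    · exact ENNReal.mul_lt_top h1 h.lt_top
  have hK := condSq_truncSq_lt_top hA w
  have hleft := exists_left_column (truncSq A hA w) u hA hJ hK
  -- Both columns are computed for the truncated `w`, then transferred through the equality of the
  -- two operators.
  have hright := exists_right_column (truncSq A hA w) u hA hJ hK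
  rw [wct_truncSq hA h0] at hleft hright
  have hr := toReal_condSq_truncSq hA w
  have hproj : (graphSum (wct A μ w u)).HasOrthogonalProjection :=
    hasOrthogonalProjection_graphSum
      (fun f => (hleft f).imp fun s h => h.imp fun r h => h.1)
      (fun g => (hright g).imp fun s h => h.imp fun r h => h.1)
  refine ⟨hproj, fun f => ?_, fun f => ?_, fun g => ?_, fun g => ?_⟩
  · obtain ⟨s, r, ⟨ha, hg⟩, hs, -⟩ := hleft f
    rw [(charMatrix_apply_left ha hg).1]
    filter_upwards [Lp.coeFn_sub f s, hs, hr] with x h1 h2 h3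
    rw [h1, Pi.sub_apply, h2]
    simp only [wctH1, wctH, h3]
  · obtain ⟨s, r, ⟨ha, hg⟩, -, hr'⟩ := hleft f
    rw [(charMatrix_apply_left ha hg).2]
    filter_upwards [hr', truncSq_mul_condExpC hA h0 f, hr] with x h1 h2 h3
    rw [h1, mul_assoc, mul_assoc, h2]
    simp only [wctH, h3]
  · obtain ⟨s, r, ⟨ha, hg⟩, hs, -⟩ := hright g
    rw [(charMatrix_apply_right ha hg).1]
    filter_upwards [hs, condExpC_star_truncSq_mul hA w g, hr,
      ae_eq_zero_of_condSq_not_lt_top hA h0] with x h1 h2 h3 h4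
    rw [h1]
    simp only [wctH, h3]
    -- Where `E(|w|²) = ∞` the expectation of `w̄g` carries no meaning, but the factor `ū` is `0`.
    by_cases h : condSq A μ w x < ∞
    · rw [h2 h]
    · simp [h4 h]
  · obtain ⟨s, r, ⟨ha, hg⟩, -, hr'⟩ := hright g
    rw [(charMatrix_apply_right ha hg).2]
    filter_upwards [hr', condExpC_star_truncSq_mul hA w g, hr, coeFn_truncSq hA w, h0]
      with x h1 h2 h3 h4 h5
    rw [h1]
    simp only [wctH2, wctH, h3]
    -- Where `E(|w|²) = ∞` the factor `E(|u|²)` in `h₂` is `0`, so both sides vanish.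
    by_cases h : condSq A μ w x < ∞
    · rw [h2 h, h4, Set.indicator_of_mem (show x ∈ {x | condSq A μ w x < ∞} from h)]
    · simp [h5 (not_lt_top_iff.1 h)]
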